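/- **Theorem.** Let $T$ be Thompson's group of piecewise linear homeomorphisms of the circle $[0,1]/(0\sim 1)$ that preserve the set of dyadic rationals and that, outside a finite set of dyadic rationals, are differentiable with slopes in $2^{\mathbb Z}$. Represent an element of $T$ by a triple $(T_+,T_-,c_-)$, where $T_+,T_-$ are rooted planar binary trees with the same number $n$ of leaves and $c_-\in\{1,\dots,n\}$: the $c_-$-th leaf of $T_-$ is joined to the first leaf of $T_+$, the other leaves are joined in cyclic order, and $g$ maps the dyadic interval of each leaf of $T_-$ affinely onto that of the leaf of $T_+$ joined to it. Let $\Gamma(T_+,T_-,c_-)$ be the following plane graph. Its $n$ vertices lie in cyclic order on the equator of the sphere, the $i$-th one just to the left of the $i$-th leaf of $T_-$, and hence also to the left of the leaf of $T_+$ joined to it. Each caret of $T_-$ (respectively $T_+$), spanning the leaves $a,\dots,b$ and with right subtree starting at the leaf $m$, gives an edge in the lower (respectively upper) hemisphere which joins the vertices at the leaves $a$ and $m$. Put $$\vec T=\{g\in T : \mathrm{Chr}_{\Gamma(g)}(2)=2\},$$ where $\Gamma(g)$ is the graph of a triple representing $g$ and $\mathrm{Chr}$ denotes the chromatic polynomial.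 For $g=g(T_+,T_-,c_-)\in\vec T$ let $\vec L(T_+,T_-,c_-)$ be the oriented link diagram obtained as the medial diagram of $\Gamma(T_+,T_-,c_-)$ (one crossing on each edge, the black regions being neighbourhoods of the vertices). It is oriented as the boundary of the Seifert surface in which the region at a vertex is oriented counterclockwise or clockwise according to its colour $+$ or $-$ in the proper $2$-colouring of the graph with colour $+$ at the first vertex. The crossings are chosen so that those on upper edges are positive and those on lower edges negative. Define the Jones function $$V_g(t)=V_{\vec L(T_+,T_-,c_-)}(t)\,\bigl(-t^{-1/2}-t^{1/2}\bigr)^{-n+1},$$ where $V_{\vec L}(t)=(-A^3)^{-\mathrm{wr}(\vec L)}\langle L\rangle(A)$, $A=t^{-1/4}$, is the Jones polynomial, $\mathrm{wr}$ is the writhe and $\langle\,\cdot\,\rangle$ is the Kauffman bracket with $\langle O\rangle=1$. Then $\vec T$ is a subgroup of $T$, and the condition $\mathrm{Chr}_{\Gamma(g)}(2)=2$ does not depend on the triple representing $g$. Moreover, for $t\in\{1,\,i,\,e^{i\pi/3},\,e^{-i\pi/3}\}$ the number $V_g(t)$, $g\in\vec T$, depends neither on the triple representing $g$ nor on the choice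 of the root $t^{1/4}$, and the function $g\mapsto V_g(t)$ is of positive type on $\vec T$: for all $r$ and all $g_1,\dots,g_r\in\vec T$ the matrix $\bigl(V_{g_ig_j^{-1}}(t)\bigr)_{i,j=1}^r$ is positive semi-definite. -/

import Mathlib

open Filter Topology
open scoped ComplexOrder

/-! ### Thompson's group `T` -/

/-- The circle `ℝ / ℤ`, i.e. `[0,1]` with identified endpoints. -/
abbrev Circle1 : Type := AddCircle (1 : ℝ)

/-- The (images in the circle of the) dyadic rationals. -/
def IsDyadic (x : Circle1) : Prop :=
  ∃ (a : ℤ) (k : ℕ), x = (((a : ℝ) / 2 ^ k : ℝ) : Circle1)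

/-- `f` is affine with slope `2 ^ k` near `x`, for some integer `k`. -/
def AffineNear (f : Circle1 → Circle1) (x : Circle1) : Prop :=
  ∃ k : ℤ, ∀ᶠ h : ℝ in 𝓝 (0 : ℝ), f (x + (h : Circle1)) = f x + (((2 : ℝ) ^ k * h : ℝ) : Circle1)

/-- Piecewise linear homeomorphisms of the circle which preserve the set of dyadic rationals, and
which, outside a finite set of dyadic rationals, are differentiable with slopes powers of `2`. -/
def IsThompson (f : Circle1 ≃ₜ Circle1) : Prop :=
  (∀ x, IsDyadic (f x) ↔ IsDyadic x) ∧
    ∃ B : Set Circle1, B.Finite ∧ (∀ x ∈ B, IsDyadic x) ∧ ∀ x, x ∉ B → AffineNear f x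

theorem IsThompson.one : IsThompson 1 :=
  ⟨fun _ => Iff.rfl, ∅, Set.finite_empty, by simp, fun x _ => ⟨0, by simp⟩⟩

theorem IsThompson.mul {f g : Circle1 ≃ₜ Circle1} (hf : IsThompson f) (hg : IsThompson g) :
    IsThompson (f * g) := by
  obtain ⟨hf1, B, hB, hBd, hfB⟩ := hf
  obtain ⟨hg1, C, hC, hCd, hgC⟩ := hg
  refine ⟨fun x => (hf1 (g x)).trans (hg1 x), C ∪ g ⁻¹' B,
    hC.union (hB.preimage g.injective.injOn), ?_, ?_⟩
  · rintro x (hx | hx)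
    · exact hCd x hx
    · exact (hg1 x).1 (hBd _ hx)
  · intro x hx
    obtain ⟨k, hk⟩ := hgC x (fun h => hx (Or.inl h))
    obtain ⟨l, hl⟩ := hfB (g x) (fun h => hx (Or.inr h))
    refine ⟨l + k, ?_⟩
    have ht : Tendsto (fun h : ℝ => (2 : ℝ) ^ k * h) (𝓝 0) (𝓝 0) := by
      have : Continuous fun h : ℝ => (2 : ℝ) ^ k * h := by fun_prop
      simpa using this.tendsto 0
    filter_upwards [hk, ht.eventually hl] with h h1 h2
    change f (g (x + h)) = f (g x) + _
    rw [h1, h2, zpow_add₀ (by norm_num), mul_assoc]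

theorem IsThompson.inv {f : Circle1 ≃ₜ Circle1} (hf : IsThompson f) : IsThompson f⁻¹ := by
  obtain ⟨hf1, B, hB, hBd, hfB⟩ := hf
  refine ⟨fun x => ?_, f '' B, hB.image _, ?_, ?_⟩
  · rw [← hf1]
    change IsDyadic (f (f.symm x)) ↔ _
    rw [f.apply_symm_apply]
  · rintro _ ⟨x, hx, rfl⟩
    exact (hf1 x).2 (hBd x hx)
  · intro y hy
    obtain ⟨x, rfl⟩ := f.surjective y
    obtain ⟨k, hk⟩ := hfB x (fun h => hy ⟨x, h, rfl⟩)
    refine ⟨-k, ?_⟩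
    have ht : Tendsto (fun h : ℝ => (2 : ℝ) ^ (-k) * h) (𝓝 0) (𝓝 0) := by
      have : Continuous fun h : ℝ => (2 : ℝ) ^ (-k) * h := by fun_prop
      simpa using this.tendsto 0
    filter_upwards [ht.eventually hk] with h h1
    change f.symm (f x + h) = f.symm (f x) + _
    rw [f.symm_apply_apply, Homeomorph.symm_apply_eq, h1, ← mul_assoc,
      ← zpow_add₀ (by norm_num : (2 : ℝ) ≠ 0)]
    simp

/-- Thompson's group `T`; multiplication is composition of maps. -/
def thompsonT : Subgroup (Circle1 ≃ₜ Circle1) where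
  carrier := {f | IsThompson f}
  one_mem' := IsThompson.one
  mul_mem' := IsThompson.mul
  inv_mem' := IsThompson.inv

/-! ### Functions of positive type -/

/-- A function `φ` on a group is of positive type if all matrices `(φ (gᵢ gⱼ⁻¹))ᵢⱼ` are positive
semi-definite. -/
def IsPositiveType {G : Type*} [Group G] (φ : G → ℂ) : Prop :=
  ∀ (r : ℕ) (g : Fin r → G), (Matrix.of fun i j => φ (g i * (g j)⁻¹)).PosSemidef

/-! ### Binary trees and tree diagrams -/

/-- Rooted planar binary trees: a single leaf, or a caret with two subtrees attached. -/
inductive BinTree : Type where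
  | leaf : BinTree
  | caret : BinTree → BinTree → BinTree

namespace BinTree

def numLeaves : BinTree → ℕ
  | leaf => 1
  | caret l r => l.numLeaves + r.numLeaves

theorem numLeaves_pos : ∀ t : BinTree, 0 < t.numLeaves
  | leaf => Nat.one_pos
  | caret l _ => Nat.add_pos_left l.numLeaves_pos _

/-- The left endpoint of the standard dyadic interval of the `i`-th leaf (`i = 0, 1, …`). -/
noncomputable def leafStart : BinTree → ℕ → ℝ
  | leaf, _ => 0
  | caret l r, i =>
      if i < l.numLeaves then l.leafStart i / 2 else (1 + r.leafStart (i - l.numLeaves)) / 2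

/-- The length of the standard dyadic interval of the `i`-th leaf. -/
noncomputable def leafLength : BinTree → ℕ → ℝ
  | leaf, _ => 1
  | caret l r, i =>
      if i < l.numLeaves then l.leafLength i / 2 else r.leafLength (i - l.numLeaves) / 2

/-- The edges of the half-graph of a tree. Its vertices `0, …, n - 1` sit just to the left of the
leaves. Every caret of the tree gives an edge: if the caret spans the leaves `a, …, b` and its right
subtree starts with the leaf `m`, the edge joins the vertices `a` and `m` (it crosses the left edge
of the caret). So every vertex `m ≠ 0` is joined to exactly one vertex on its left,
`leftNeighbour t m`. -/
def leftNeighbour : BinTree → ℕ → ℕ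
  | leaf, _ => 0
  | caret l r, m =>
      if m < l.numLeaves then l.leftNeighbour m
      else if m = l.numLeaves then 0
      else l.numLeaves + r.leftNeighbour (m - l.numLeaves)

theorem leftNeighbour_lt : ∀ (t : BinTree) (m : ℕ), 0 < m → t.leftNeighbour m < m
  | leaf, _, h => h
  | caret l r, m, h => by
      rw [leftNeighbour]
      split_ifs with h1 h2
      · exact l.leftNeighbour_lt m h
      · exact h
      · have := r.leftNeighbour_lt (m - l.numLeaves) (by omega)
        omega

end BinTree

/-- A pair of binary trees with the same number `n` of leaves and a marked leaf of the bottom tree,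
`(T₊, T₋, c₋)`; leaves are counted from `0`, so `mark = c₋ - 1`. -/
structure TreeDiagram : Type where
  top : BinTree
  bottom : BinTree
  numLeaves_eq : top.numLeaves = bottom.numLeaves
  mark : ℕ
  mark_lt : mark < bottom.numLeaves

namespace TreeDiagram

variable (D : TreeDiagram)

/-- The common number of leaves. -/
abbrev n : ℕ := D.bottom.numLeaves

/-- `D` describes `g ∈ T`: the marked leaf of the bottom tree is joined to the first leaf of the top
tree, the other leaves are joined in cyclic order, and `g` maps the interval of each leaf of the
bottom tree affinely onto the interval of the leaf of the top tree it is joined to. -/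
def Represents (g : thompsonT) : Prop :=
  ∀ j : ℕ, j < D.n → ∀ x : ℝ, 0 ≤ x → x < 1 →
    (g : Circle1 ≃ₜ Circle1)
        ((D.bottom.leafStart ((D.mark + j) % D.n) +
          x * D.bottom.leafLength ((D.mark + j) % D.n) : ℝ) : Circle1) =
      ((D.top.leafStart j + x * D.top.leafLength j : ℝ) : Circle1)

/-! ### The graph of a tree diagram

The vertices `ZMod n` lie in cyclic order on the equator of the sphere; the half-graph of the bottom
tree is drawn in the lower hemisphere, and the half-graph of the top tree, rotated so that its first
vertex comes to the marked position, in the upper hemisphere. (Cut open at one point the equator is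
a line, with the edges drawn as upper and lower arcs.) -/

/-- The edges: `(true, i)` is the edge of the top tree and `(false, i)` that of the bottom tree
which joins the vertex `i + 1` of the half-graph to its left neighbour. -/
abbrev Edge : Type := Bool × Fin (D.n - 1)

/-- The ends of edges: `(e, true)` is the end at the vertex `i + 1` of the half-graph, `(e, false)`
the end at its left neighbour. -/
abbrev EdgeEnd : Type := D.Edge × Bool

/-- The vertex at an end of an edge. -/
def vertex : D.EdgeEnd → ZMod D.n
  | ((true, i), h) =>
      (((if h then (i : ℕ) + 1 else D.top.leftNeighbour (i + 1)) + D.mark : ℕ) : ZMod D.n)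
  | ((false, i), h) =>
      ((if h then (i : ℕ) + 1 else D.bottom.leftNeighbour (i + 1) : ℕ) : ZMod D.n)

/-- The other end of the same edge. -/
def otherEnd (d : D.EdgeEnd) : D.EdgeEnd := (d.1, !d.2)

theorem vertex_ne (e : D.Edge) : D.vertex (e, true) ≠ D.vertex (e, false) := by
  obtain ⟨b, i⟩ := e
  have hi := i.2
  have key : ∀ t : BinTree,
      (((i : ℕ) + 1 : ℕ) : ZMod D.n) ≠ ((t.leftNeighbour (i + 1) : ℕ) : ZMod D.n) := by
    intro t h
    have hlt := t.leftNeighbour_lt (i + 1) (Nat.succ_pos _)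
    rw [ZMod.natCast_eq_natCast_iff', Nat.mod_eq_of_lt (by omega), Nat.mod_eq_of_lt (by omega)] at h
    omega
  cases b
  · simpa [vertex] using key D.bottom
  · simpa [vertex] using key D.top

/-- The graph `Γ(T₊, T₋, c₋)` (only adjacency is recorded here, parallel edges do not matter for
colourings). -/
def graph : SimpleGraph (ZMod D.n) where
  Adj u v := ∃ d : D.EdgeEnd, D.vertex d = u ∧ D.vertex (D.otherEnd d) = v
  symm := ⟨by
    rintro u v ⟨⟨e, b⟩, hu, hv⟩
    exact ⟨(e, !b), hv, by simpa [otherEnd] using hu⟩⟩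
  loopless := ⟨by
    rintro v ⟨⟨e, b⟩, hu, hv⟩
    cases b
    · exact D.vertex_ne e (hv.trans hu.symm)
    · exact D.vertex_ne e (hu.trans hv.symm)⟩

end TreeDiagram

/-- The value at `k` of the chromatic polynomial: the number of proper `k`-colourings. -/
noncomputable def chromaticValue {V : Type*} (G : SimpleGraph V) (k : ℕ) : ℕ :=
  Nat.card (G.Coloring (Fin k))

/-- Membership of `g ∈ T` in the oriented Thompson group: the chromatic polynomial of the graph of a
tree diagram of `g` takes the value `2` at `2`. -/
def IsOrientedElement (g : thompsonT) : Prop :=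
  ∃ D : TreeDiagram, D.Represents g ∧ chromaticValue D.graph 2 = 2

/-! ### Link diagrams, the Kauffman bracket and the Jones polynomial -/

/-- A link diagram, given by its crossings and the arcs between them. Every crossing `c` has four
half-edges `(c, 0), (c, 1), (c, 2), (c, 3)` in counterclockwise order, with `(c, 0), (c, 2)` forming
the under-strand and `(c, 1), (c, 3)` the over-strand; `arc` exchanges the two half-edges at the
ends of an arc of the diagram; `circles` is the number of components without crossings. -/
structure LinkDiagram : Type 1 where
  Crossing : Type
  [fintypeCrossing : Fintype Crossing]
  [decEqCrossing : DecidableEq Crossing]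
  arc : Equiv.Perm (Crossing × Fin 4)
  arc_arc : ∀ h, arc (arc h) = h
  arc_ne : ∀ h, arc h ≠ h
  circles : ℕ

attribute [instance] LinkDiagram.fintypeCrossing LinkDiagram.decEqCrossing

namespace LinkDiagram

variable (L : LinkDiagram)

/-- The half-edge to which a half-edge is connected after smoothing the crossings according to the
state `s` (`true`: the `A`-smoothing, which joins the two regions swept out when the over-strand is
rotated counterclockwise; `false`: the other smoothing). -/
def smooth (s : L.Crossing → Bool) (h : L.Crossing × Fin 4) : L.Crossing × Fin 4 :=
  (h.1, if s h.1 then ![1, 0, 3, 2] h.2 else ![3, 2, 1, 0] h.2)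

/-- The number of closed curves of a state. -/
noncomputable def loops (s : L.Crossing → Bool) : ℕ :=
  Nat.card (Quot fun h h' : L.Crossing × Fin 4 => h' = L.arc h ∨ h' = L.smooth s h) + L.circles

/-- The Kauffman bracket `⟨L⟩(A)` of a non-empty diagram, normalised by `⟨O⟩ = 1`. -/
noncomputable def kauffmanBracket (A : ℂ) : ℂ :=
  ∑ s : L.Crossing → Bool,
    A ^ (∑ c : L.Crossing, if s c then (1 : ℤ) else -1) *
      (-A ^ 2 - A ^ (-2 : ℤ)) ^ (L.loops s - 1)

/-- An orientation: `inward h` tells whether the strand at the half-edge `h` runs into the crossing.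
(The circles without crossings need no orientation for what follows.) -/
structure Orientation : Type where
  inward : L.Crossing × Fin 4 → Bool
  arc_inward : ∀ h, inward (L.arc h) = !(inward h)
  under_inward : ∀ c, inward (c, 2) = !(inward (c, 0))
  over_inward : ∀ c, inward (c, 3) = !(inward (c, 1))

variable {L}

/-- The sign of a crossing: it is positive if, seen along the incoming under-strand at half-edge
`0`, the over-strand passes from the left, `3`, to the right, `1` (or with both strands
reversed). -/
def Orientation.sign (o : L.Orientation) (c : L.Crossing) : ℤ :=
  if o.inward (c, 0) = o.inward (c, 3) then 1 else -1

def Orientation.writhe (o : L.Orientation) : ℤ := ∑ c : L.Crossing, o.sign c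

/-- The Jones polynomial `V_L(t)` evaluated at `t ^ (-1/4) = A`. -/
noncomputable def Orientation.jones (o : L.Orientation) (A : ℂ) : ℂ :=
  (-A ^ 3) ^ (-o.writhe) * L.kauffmanBracket A

end LinkDiagram

/-! ### The oriented link diagram of a tree diagram

It is the medial diagram of the graph embedded in the sphere: one crossing on every edge, the black
regions being neighbourhoods of the vertices. -/

namespace TreeDiagram

variable (D : TreeDiagram)

/-- The position of an end of an edge in the counterclockwise order around its vertex, starting on
the equator from the side of the following vertices: first come the edges in the upper hemisphere,
by increasing distance, in the positive cyclic direction, to the vertex at the other end; then those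
in the lower hemisphere, by decreasing such distance. -/
def position (d : D.EdgeEnd) : ℕ :=
  if d.1.1 then (D.vertex (D.otherEnd d) - D.vertex d).val
  else 2 * D.n - (D.vertex (D.otherEnd d) - D.vertex d).val

/-- The ends of edges at a vertex, listed counterclockwise. -/
noncomputable def endsAt (v : ZMod D.n) : List D.EdgeEnd :=
  ((Finset.univ : Finset D.EdgeEnd).toList.filter fun d => D.vertex d = v).mergeSort
    fun d d' => D.position d ≤ D.position d'

theorem mem_endsAt {v : ZMod D.n} {d : D.EdgeEnd} : d ∈ D.endsAt v ↔ D.vertex d = v := by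
  simp [endsAt]

/-- The next end of an edge counterclockwise around the same vertex (cyclically). -/
noncomputable def nextAround (d : D.EdgeEnd) : D.EdgeEnd := (D.endsAt (D.vertex d)).formPerm d

/-- The previous end. -/
noncomputable def prevAround (d : D.EdgeEnd) : D.EdgeEnd := (D.endsAt (D.vertex d)).formPerm⁻¹ d

theorem vertex_nextAround (d : D.EdgeEnd) : D.vertex (D.nextAround d) = D.vertex d :=
  D.mem_endsAt.1 (List.formPerm_apply_mem_of_mem (D.mem_endsAt.2 rfl))

theorem vertex_prevAround (d : D.EdgeEnd) : D.vertex (D.prevAround d) = D.vertex d := by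
  refine D.mem_endsAt.1 ?_
  rw [prevAround, ← List.formPerm_reverse]
  have h : d ∈ (D.endsAt (D.vertex d)).reverse := by simp [mem_endsAt]
  exact List.mem_reverse.1 (List.formPerm_apply_mem_of_mem h)

theorem prev_next (d : D.EdgeEnd) : D.prevAround (D.nextAround d) = d := by
  rw [prevAround, vertex_nextAround, nextAround]
  exact Equiv.symm_apply_apply _ d

theorem next_prev (d : D.EdgeEnd) : D.nextAround (D.prevAround d) = d := by
  rw [nextAround, vertex_prevAround, prevAround]
  exact Equiv.apply_symm_apply _ d

/-- The corners at the end of an edge: `(d, true)` is the side counterclockwise after `d`, as seen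
from the vertex, `(d, false)` the side before. An arc of the medial diagram joins the side after `d`
to the side before the next end of an edge around the same vertex. -/
noncomputable def cornerArc : D.EdgeEnd × Bool → D.EdgeEnd × Bool
  | (d, true) => (D.nextAround d, false)
  | (d, false) => (D.prevAround d, true)

/-- Draw an edge horizontally, with its end `(e, false)` on the left and `(e, true)` on the right.
At the crossing in its middle the half-edges pointing south-east, north-east, north-west, south-west
belong to the four corners `(right, after)`, `(right, before)`, `(left, after)`, `(left, before)`.
For an edge in the upper hemisphere they get the labels `0, 1, 2, 3` (the over-strand joins
south-west and north-east), for an edge in the lower hemisphere the labels `1, 2, 3, 0` (the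
over-strand joins south-east and north-west). -/
def corner : (D.Edge × Fin 4) ≃ (D.EdgeEnd × Bool) where
  toFun h :=
    ![((h.1, true), true), ((h.1, true), false), ((h.1, false), true), ((h.1, false), false)]
      (if h.1.1 then h.2 else h.2 + 3)
  invFun x :=
    (x.1.1, (if x.1.2 then (if x.2 then 0 else 1) else (if x.2 then 2 else 3)) +
      (if x.1.1.1 then (0 : Fin 4) else 1))
  left_inv := by
    rintro ⟨⟨b, i⟩, k⟩
    cases b <;> fin_cases k <;> simp
  right_inv := by
    rintro ⟨⟨⟨b, i⟩, h⟩, a⟩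
    cases b <;> cases h <;> cases a <;> rfl

theorem cornerArc_cornerArc (x : D.EdgeEnd × Bool) : D.cornerArc (D.cornerArc x) = x := by
  obtain ⟨d, a⟩ := x
  cases a
  · simp [cornerArc, next_prev]
  · simp [cornerArc, prev_next]

theorem cornerArc_ne (x : D.EdgeEnd × Bool) : D.cornerArc x ≠ x := by
  obtain ⟨d, a⟩ := x
  cases a <;> simp [cornerArc]

/-- The link diagram `L(T₊, T₋, c₋)`. (A vertex without edges, which occurs only for `n = 1`,
contributes a circle.) -/
noncomputable def link : LinkDiagram where
  Crossing := D.Edge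
  arc := (D.corner.trans
    ⟨D.cornerArc, D.cornerArc, D.cornerArc_cornerArc, D.cornerArc_cornerArc⟩).trans D.corner.symm
  arc_arc h := by simp [cornerArc_cornerArc]
  arc_ne h heq := D.cornerArc_ne (D.corner h) (by simpa using congrArg D.corner heq)
  circles := Nat.card {v : ZMod D.n // ∀ d, D.vertex d ≠ v}

theorem coloring_ne (σ : D.graph.Coloring Bool) (e : D.Edge) :
    σ (D.vertex (e, true)) = !(σ (D.vertex (e, false))) := by
  have h : D.graph.Adj (D.vertex (e, true)) (D.vertex (e, false)) := ⟨(e, true), rfl, rfl⟩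
  have := σ.valid h
  revert this
  cases σ (D.vertex (e, true)) <;> cases σ (D.vertex (e, false)) <;> simp

/-- The orientation of the link as the boundary of the Seifert surface obtained from a proper
2-colouring of the graph: the black region around a vertex is oriented counterclockwise if its
colour is `+` (`true`) and clockwise otherwise. So for `+` the strand at the corner `(d, false)`
runs into the crossing and the one at `(d, true)` out of it; for `-` it is the other way round. -/
noncomputable def orientation (σ : D.graph.Coloring Bool) : D.link.Orientation where
  inward h := xor (σ (D.vertex (D.corner h).1)) (D.corner h).2
  arc_inward h := by
    have : D.corner (D.link.arc h) = D.cornerArc (D.corner h) :=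
      D.corner.apply_symm_apply _
    rw [this]
    generalize D.corner h = x
    obtain ⟨d, a⟩ := x
    cases a <;> simp [cornerArc, vertex_nextAround, vertex_prevAround]
  under_inward e := by
    obtain ⟨b, i⟩ := e
    have := D.coloring_ne σ (b, i)
    cases b <;> simp [corner, this]
  over_inward e := by
    obtain ⟨b, i⟩ := e
    have := D.coloring_ne σ (b, i)
    cases b <;> simp [corner, this]

/-- The normalised Jones polynomial `V_L(t) (-t^(-1/2) - t^(1/2))^(-n+1)`, evaluated at
`t ^ (-1/4) = A`, of the link of `D` oriented by means of the colouring `σ`. -/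
noncomputable def jonesValue (σ : D.graph.Coloring Bool) (A : ℂ) : ℂ :=
  (D.orientation σ).jones A * (-A ^ 2 - A ^ (-2 : ℤ)) ^ (-(D.n : ℤ) + 1)

end TreeDiagram

/-- `V` is the Jones function `g ↦ V_g(t)` on a subgroup `H` of `T`: for every `g ∈ H`, every tree
diagram `D` of `g`, the proper 2-colouring of its graph with colour `+` at the first vertex, and
every choice of the fourth root `A = t ^ (-1/4)`, the value `V g` is the normalised Jones polynomial
of the oriented link of `D`. -/
def IsJonesFunction {H : Subgroup thompsonT} (t : ℂ) (V : H → ℂ) : Prop :=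
  ∀ (g : H) (D : TreeDiagram), D.Represents g → ∀ σ : D.graph.Coloring Bool, σ 0 = true →
    ∀ A : ℂ, A ^ (-4 : ℤ) = t → V g = D.jonesValue σ A

/-! ### Counting classes of a relation -/

/-! At the four values of `t`, the number `q = t + 2 + t⁻¹` is a positive integer (4, 2, 3, 3) and
`|t| = 1`. The Jones function is then a `q`-colour Potts partition function. A state of the Kauffman
bracket is a set `S` of edges along which black regions are joined, and its loops bound the
subsurface given by `S`. Euler's formula (`boundaries_add_n`) says that loops plus `n` equals `|S|`
plus twice the number of components of `S`. With `d = -A² - A⁻²`, `d² = q`, the bracket becomes a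
sum over `S` of edge weights times `q` to the number of components. The Fortuin-Kasteleyn identity
turns this into `q⁻ⁿ` times a sum over all colourings of the vertices (`jonesValue_eq`): a
monochromatic edge weighs `-t` above the equator and `-t⁻¹` below it, any other edge weighs 1. The
writhe is 0 and all powers of the root `A` cancel. Independence of the diagram: splitting two joined
leaves adds a vertex with one upper and one lower edge to the same old vertex. As `(-t)(-t⁻¹) = 1`,
summing over its colour gives the factor `q`, which the normalisation absorbs. Any two diagrams of
an element have a common expansion. Positivity: give the elements diagrams with one common bottom
tree. The diagram of `gᵢ gⱼ⁻¹` then consists of two top trees, and because the conjugate of `-t` is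
`-t⁻¹`, its partition function is the inner product of the weight vectors of `gᵢ` and `gⱼ`: the
matrix is a Gram matrix up to a positive factor. The subgroup comes from the same machinery with
weight 0 on monochromatic edges and two colours, which counts proper 2-colourings. Each half-graph
has exactly two of these, so the chromatic value is 2 exactly when both half-graphs have the same
ones, a condition that passes to quotients. -/

/-- The relation `r` with one more related pair. -/
def addPair {α : Type*} (r : α → α → Prop) (a b : α) : α → α → Prop :=
  fun x y => r x y ∨ (x = a ∧ y = b)

theorem quot_mk_addPair {α : Type*} {r : α → α → Prop} {a b x y : α}
    (h : Quot.mk r x = Quot.mk r y) : Quot.mk (addPair r a b) x = Quot.mk (addPair r a b) y :=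
  congrArg (Quot.map id (fun _ _ h => Or.inl h) : Quot r → Quot (addPair r a b)) h

/-- Relations which generate the same equivalence have equally many classes. -/
theorem card_quot_congr {α : Type*} {r s : α → α → Prop}
    (h : ∀ x y, r x y → Quot.mk s x = Quot.mk s y)
    (h' : ∀ x y, s x y → Quot.mk r x = Quot.mk r y) : Nat.card (Quot r) = Nat.card (Quot s) :=
  Nat.card_congr
    { toFun := Quot.lift (Quot.mk s) h
      invFun := Quot.lift (Quot.mk r) h'
      left_inv := by rintro ⟨x⟩; rfl
      right_inv := by rintro ⟨x⟩; rfl }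

theorem card_quot_addPair_of_eq {α : Type*} {r : α → α → Prop} {a b : α}
    (h : Quot.mk r a = Quot.mk r b) : Nat.card (Quot (addPair r a b)) = Nat.card (Quot r) := by
  refine card_quot_congr ?_ fun x y hxy => Quot.sound (Or.inl hxy)
  rintro x y (hxy | ⟨rfl, rfl⟩)
  · exact Quot.sound hxy
  · exact h

/-- The class of `b` is absorbed by that of `a`, so the new classes correspond to the old classes
other than that of `b`. -/
theorem card_quot_addPair_of_ne {α : Type*} [Finite α] {r : α → α → Prop} {a b : α}
    (h : Quot.mk r a ≠ Quot.mk r b) : Nat.card (Quot (addPair r a b)) + 1 = Nat.card (Quot r) := by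
  classical
  have e : Quot (addPair r a b) ≃ {q : Quot r // q ≠ Quot.mk r b} :=
    { toFun := Quot.lift
        (fun x => if hx : Quot.mk r x = Quot.mk r b then ⟨Quot.mk r a, h⟩ else ⟨Quot.mk r x, hx⟩)
        (by
          rintro x y (hxy | ⟨rfl, rfl⟩)
          · simp only [Quot.sound hxy]
          · simp [h])
      invFun := fun q => Quot.map id (fun _ _ h => Or.inl h) q.1
      left_inv := by
        rintro ⟨x⟩
        by_cases hx : Quot.mk r x = Quot.mk r b
        · simp only [hx, dite_true]
          have h1 : Quot.mk (addPair r a b) a = Quot.mk _ b := Quot.sound (Or.inr ⟨rfl, rfl⟩)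
          exact h1.trans (quot_mk_addPair hx).symm
        · simp only [hx, dite_false]
          rfl
      right_inv := by
        rintro ⟨⟨x⟩, hx⟩
        exact dif_neg hx }
  have := Fintype.ofFinite (Quot r)
  rw [Nat.card_congr e, Nat.card_eq_fintype_card, Nat.card_eq_fintype_card,
    Fintype.card_subtype_compl, Fintype.card_subtype_eq]
  exact Nat.sub_add_cancel (Fintype.card_pos_iff.2 ⟨Quot.mk r b⟩)

theorem card_quot_le_addPair {α : Type*} [Finite α] (r : α → α → Prop) (a b : α) :
    Nat.card (Quot r) ≤ Nat.card (Quot (addPair r a b)) + 1 := by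
  by_cases h : Quot.mk r a = Quot.mk r b
  · rw [card_quot_addPair_of_eq h]; exact Nat.le_succ _
  · rw [card_quot_addPair_of_ne h]

theorem card_quot_addPair_le {α : Type*} [Finite α] (r : α → α → Prop) (a b : α) :
    Nat.card (Quot (addPair r a b)) ≤ Nat.card (Quot r) := by
  by_cases h : Quot.mk r a = Quot.mk r b
  · rw [card_quot_addPair_of_eq h]
  · rw [← card_quot_addPair_of_ne h]; exact Nat.le_succ _

/-- The number of orbits of a self-map. -/
noncomputable def orbitCount {α : Type*} (f : α → α) : ℕ := Nat.card (Quot fun x y => y = f x)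

section Swap

variable {α : Type*} [DecidableEq α] (π : Equiv.Perm α) (a b : α)

/-- Once `a` and `b` are identified the transposition is invisible. This allows the orbits of the
two permutations to be compared through a common quotient. -/
theorem card_quot_addPair_swap :
    Nat.card (Quot (addPair (fun x y => y = (Equiv.swap a b * π) x) a b)) =
      Nat.card (Quot (addPair (fun x y => y = π x) a b)) := by
  have key : ∀ (r : α → α → Prop) (x : α),
      Quot.mk (addPair r a b) (Equiv.swap a b x) = Quot.mk (addPair r a b) x := by
    intro r x
    have h : Quot.mk (addPair r a b) a = Quot.mk (addPair r a b) b :=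
      Quot.sound (Or.inr ⟨rfl, rfl⟩)
    rw [Equiv.swap_apply_def]
    split_ifs with h1 h2
    · rw [h1, h]
    · rw [h2, h]
    · rfl
  refine card_quot_congr ?_ ?_
  · rintro x y (rfl | ⟨rfl, rfl⟩)
    · rw [Equiv.Perm.mul_apply, key]
      exact Quot.sound (Or.inl rfl)
    · exact Quot.sound (Or.inr ⟨rfl, rfl⟩)
  · rintro x y (rfl | ⟨rfl, rfl⟩)
    · rw [← key _ (π x), ← Equiv.Perm.mul_apply]
      exact Quot.sound (Or.inl rfl)
    · exact Quot.sound (Or.inr ⟨rfl, rfl⟩)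

/-- Composing with a transposition creates at most one new orbit. -/
theorem orbitCount_swap_mul_le [Finite α] :
    orbitCount (Equiv.swap a b * π) ≤ orbitCount π + 1 := by
  refine (card_quot_le_addPair _ a b).trans ?_
  rw [card_quot_addPair_swap]
  exact Nat.succ_le_succ (card_quot_addPair_le _ a b)

/-- Composing with a transposition of points in different orbits joins these. -/
theorem orbitCount_swap_mul_of_ne [Finite α]
    (h : Quot.mk (fun x y => y = π x) a ≠ Quot.mk (fun x y => y = π x) b) :
    orbitCount (Equiv.swap a b * π) + 1 = orbitCount π := by
  classical
  have hpow : ∀ i : ℕ, Quot.mk (fun x y => y = π x) ((π ^ i) a) = Quot.mk _ a := by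
    intro i
    induction i with
    | zero => rfl
    | succ i ih =>
      rw [← ih, pow_succ', Equiv.Perm.mul_apply]
      exact (Quot.sound (r := fun x y => y = π x) rfl).symm
  have hex : ∃ i : ℕ, (π ^ (i + 1)) a = a :=
    ⟨orderOf π - 1, by rw [Nat.sub_add_cancel (orderOf_pos π), pow_orderOf_eq_one]; rfl⟩
  -- Before its first return to `a`, the `π`-orbit of `a` meets neither `a` nor `b`, so the
  -- composite moves along it as `π` does; at the return it is diverted to `b`.
  have hlt : ∀ i ≤ Nat.find hex, Quot.mk (fun x y => y = (Equiv.swap a b * π) x) ((π ^ i) a) =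
      Quot.mk _ a := by
    intro i
    induction i with
    | zero => intro _; rfl
    | succ i ih =>
      intro hi
      rw [← ih (by omega)]
      have h1 : (π ^ (i + 1)) a ≠ a := Nat.find_min hex hi
      have h2 : (π ^ (i + 1)) a ≠ b := fun hb => h (by rw [← hb, hpow])
      refine (Quot.sound ?_).symm
      rw [Equiv.Perm.mul_apply, ← Equiv.Perm.mul_apply π, ← pow_succ',
        Equiv.swap_apply_of_ne_of_ne h1 h2]
  have hab : Quot.mk (fun x y => y = (Equiv.swap a b * π) x) a = Quot.mk _ b := by
    rw [← hlt _ le_rfl]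
    refine Quot.sound ?_
    rw [Equiv.Perm.mul_apply, ← Equiv.Perm.mul_apply π, ← pow_succ', Nat.find_spec hex,
      Equiv.swap_apply_left]
  rw [orbitCount, ← card_quot_addPair_of_eq hab, card_quot_addPair_swap]
  exact card_quot_addPair_of_ne h

end Swap

/-! ### Euler's formula for the subgraphs of a plane graph

The graph is given by its edges `E`, whose ends are `E × Bool`, by the vertex at every end, and by
the permutation which gives the next end around a vertex. -/

namespace RibbonGraph

/-- Adjacency by an edge in `S`. -/
def joined {E V : Type*} (vert : E × Bool → V) (S : Finset E) (u v : V) : Prop :=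
  ∃ e ∈ S, vert (e, true) = u ∧ vert (e, false) = v

/-- The number of connected components of the subgraph with all vertices and the edges in `S`. -/
noncomputable def components {E V : Type*} (vert : E × Bool → V) (S : Finset E) : ℕ :=
  Nat.card (Quot (joined vert S))

theorem components_empty {E V : Type*} (vert : E × Bool → V) :
    components vert (∅ : Finset E) = Nat.card V :=
  Nat.card_congr
    { toFun := Quot.lift id (by rintro _ _ ⟨e, he, -⟩; simp at he)
      invFun := Quot.mk _
      left_inv := by rintro ⟨x⟩; rfl
      right_inv := fun _ => rfl }

variable {E V : Type*} [DecidableEq E]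

/-- The permutation which exchanges the ends of the edges in `S`. -/
def flip (S : Finset E) : Equiv.Perm (E × Bool) where
  toFun d := (d.1, if d.1 ∈ S then !d.2 else d.2)
  invFun d := (d.1, if d.1 ∈ S then !d.2 else d.2)
  left_inv := by rintro ⟨e, b⟩; by_cases h : e ∈ S <;> simp [h]
  right_inv := by rintro ⟨e, b⟩; by_cases h : e ∈ S <;> simp [h]

theorem flip_apply (S : Finset E) (d : E × Bool) :
    flip S d = (d.1, if d.1 ∈ S then !d.2 else d.2) := rfl

theorem flip_empty : flip (∅ : Finset E) = 1 := by
  ext d <;> simp [flip_apply]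

theorem flip_insert {S : Finset E} {e : E} (he : e ∉ S) :
    flip (insert e S) = Equiv.swap (e, true) (e, false) * flip S := by
  refine Equiv.ext ?_
  rintro ⟨x, b⟩
  rw [Equiv.Perm.mul_apply, flip_apply, flip_apply]
  by_cases hx : x = e
  · subst hx
    cases b <;> simp [he]
  · rw [Equiv.swap_apply_of_ne_of_ne] <;> simp [hx]

/-- The number of boundary components of the subsurface given by the edges in `S`. -/
noncomputable def boundaries (ν : Equiv.Perm (E × Bool)) (S : Finset E) : ℕ :=
  orbitCount (flip S * ν)

variable (vert : E × Bool → V) (ν : Equiv.Perm (E × Bool))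

theorem joined_insert (S : Finset E) (e : E) :
    joined vert (insert e S) = addPair (joined vert S) (vert (e, true)) (vert (e, false)) := by
  ext u v
  constructor
  · rintro ⟨x, hx, hu, hv⟩
    rcases Finset.mem_insert.1 hx with rfl | hx
    · exact Or.inr ⟨hu.symm, hv.symm⟩
    · exact Or.inl ⟨x, hx, hu, hv⟩
  · rintro (⟨x, hx, hu, hv⟩ | ⟨rfl, rfl⟩)
    · exact ⟨x, Finset.mem_insert_of_mem hx, hu, hv⟩
    · exact ⟨e, Finset.mem_insert_self _ _, rfl, rfl⟩

variable {vert ν}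

/-- A boundary walk only turns around vertices and passes along edges of `S`, so it stays in one
component. Used contrapositively: ends in different components lie on different boundary curves. -/
theorem component_eq_of_orbit_eq (hvert : ∀ d, vert (ν d) = vert d) (S : Finset E)
    {d d' : E × Bool}
    (h : Quot.mk (fun x y => y = (flip S * ν) x) d = Quot.mk (fun x y => y = (flip S * ν) x) d') :
    Quot.mk (joined vert S) (vert d) = Quot.mk (joined vert S) (vert d') := by
  have hf : ∀ x, Quot.mk (joined vert S) (vert (flip S x)) = Quot.mk _ (vert x) := by
    rintro ⟨e, b⟩
    rw [flip_apply]
    by_cases he : e ∈ S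
    · have h1 : Quot.mk (joined vert S) (vert (e, true)) = Quot.mk _ (vert (e, false)) :=
        Quot.sound ⟨e, he, rfl, rfl⟩
      cases b <;> simp [he, h1]
    · simp [he]
  refine congrArg (Quot.lift (fun d => Quot.mk (joined vert S) (vert d)) ?_) h
  rintro x _ rfl
  rw [Equiv.Perm.mul_apply, hf, hvert]

/-- Without edges each boundary curve circles one vertex. There is only an inequality because
isolated vertices have no edge ends. -/
theorem boundaries_empty_le [Finite V] (hvert : ∀ d, vert (ν d) = vert d)
    (hν : ∀ d d', vert d = vert d' → Quot.mk (fun x y => y = ν x) d = Quot.mk _ d') :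
    boundaries ν (∅ : Finset E) ≤ Nat.card V := by
  rw [boundaries, flip_empty, one_mul]
  refine Nat.card_le_card_of_injective (Quot.lift vert ?_) ?_
  · rintro x _ rfl
    exact (hvert x).symm
  · rintro ⟨x⟩ ⟨y⟩ h
    exact hν x y h

variable [Finite E] [Finite V]

/-- An edge inside a component adds at most one boundary curve; an edge between two components
merges two curves and two components. So boundaries minus twice the components grows by at most 1.
-/
theorem boundaries_insert_add_le (hvert : ∀ d, vert (ν d) = vert d) {S : Finset E} {e : E}
    (he : e ∉ S) :
    boundaries ν (insert e S) + 2 * components vert S ≤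
      boundaries ν S + 2 * components vert (insert e S) + 1 := by
  have h1 : boundaries ν (insert e S) =
      orbitCount (Equiv.swap (e, true) (e, false) * (flip S * ν)) := by
    rw [boundaries, flip_insert he, mul_assoc]
  have h2 : components vert (insert e S) =
      Nat.card (Quot (addPair (joined vert S) (vert (e, true)) (vert (e, false)))) := by
    rw [components, joined_insert]
  by_cases h : Quot.mk (joined vert S) (vert (e, true)) = Quot.mk _ (vert (e, false))
  · have h3 : components vert (insert e S) = components vert S :=
      h2.trans (card_quot_addPair_of_eq h)
    have h4 := orbitCount_swap_mul_le (flip S * ν) (e, true) (e, false)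
    rw [h1, h3]
    change _ ≤ boundaries ν S + 1 at h4
    omega
  · have h3 : components vert (insert e S) + 1 = components vert S := by
      rw [h2]; exact card_quot_addPair_of_ne h
    have h4 := orbitCount_swap_mul_of_ne (flip S * ν) (e, true) (e, false)
      fun h' => h (component_eq_of_orbit_eq hvert S h')
    rw [← h1] at h4
    change _ = boundaries ν S at h4
    omega

theorem boundaries_add_le (hvert : ∀ d, vert (ν d) = vert d) (S T : Finset E)
    (hST : Disjoint S T) :
    boundaries ν (S ∪ T) + 2 * components vert S ≤
      boundaries ν S + 2 * components vert (S ∪ T) + T.card := by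
  induction T using Finset.induction_on with
  | empty => simp
  | insert e T he ih =>
    rw [Finset.disjoint_insert_right] at hST
    have h := boundaries_insert_add_le (vert := vert) (ν := ν) hvert (S := S ∪ T) (e := e)
      (by simp [he, hST.1])
    have h' := ih hST.2
    rw [Finset.union_insert, Finset.card_insert_of_notMem he]
    omega

/-- If the whole ribbon graph is connected and has as many faces as a plane graph, every subgraph
satisfies Euler's formula. -/
theorem boundaries_add_card [Fintype E] (hvert : ∀ d, vert (ν d) = vert d)
    (hν : ∀ d d', vert d = vert d' → Quot.mk (fun x y => y = ν x) d = Quot.mk _ d')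
    (hconn : components vert (Finset.univ : Finset E) ≤ 1)
    (hfaces : 2 + Fintype.card E ≤ boundaries ν (Finset.univ : Finset E) + Nat.card V)
    (S : Finset E) :
    boundaries ν S + Nat.card V = 2 * components vert S + S.card := by
  -- A squeeze: growing from `∅` to `S` bounds the boundaries of `S` above, growing from `S` to all
  -- edges bounds them below, and the face count leaves no slack between the bounds.
  have h1 := boundaries_empty_le hvert hν
  have h2 := boundaries_add_le (vert := vert) (ν := ν) hvert ∅ S (Finset.disjoint_empty_left _)
  have h3 := boundaries_add_le (vert := vert) (ν := ν) hvert S Sᶜ disjoint_compl_right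
  rw [Finset.empty_union, components_empty] at h2
  rw [Finset.union_compl, Finset.card_compl] at h3
  have h4 := Finset.card_le_univ S
  omega

end RibbonGraph

/-- The number of colourings which are constant on classes. -/
theorem card_constant_colorings {V : Type*} [Fintype V] [DecidableEq V] (r : V → V → Prop) (q : ℕ) :
    Nat.card {σ : V → Fin q // ∀ u v, r u v → σ u = σ v} = q ^ Nat.card (Quot r) := by
  classical
  have e : {σ : V → Fin q // ∀ u v, r u v → σ u = σ v} ≃ (Quot r → Fin q) :=
    { toFun := fun σ => Quot.lift σ.1 σ.2
      invFun := fun f => ⟨fun v => f (Quot.mk r v), fun u v h => congrArg f (Quot.sound h)⟩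
      left_inv := fun _ => rfl
      right_inv := fun f => by ext ⟨x⟩; rfl }
  rw [Nat.card_congr e, Nat.card_fun, Nat.card_fin]

/-- The Fortuin-Kasteleyn expansion of the partition function of the Potts model. -/
theorem fortuin_kasteleyn {E V : Type*} [Fintype E] [DecidableEq E] [Fintype V] [DecidableEq V]
    (vert : E × Bool → V) (q : ℕ) (x y : E → ℂ) :
    ∑ S : Finset E, (∏ e, if e ∈ S then y e else x e) * (q : ℂ) ^ RibbonGraph.components vert S =
      ∑ σ : V → Fin q, ∏ e,
        (x e + if σ (vert (e, true)) = σ (vert (e, false)) then y e else 0) := by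
  classical
  -- `q` to the number of components counts the colourings constant on components, that is, those
  -- monochromatic on each edge of `S`. After exchanging the sums, the sum over `S` is an expanded
  -- product.
  have h1 : ∀ S : Finset E, (q : ℂ) ^ RibbonGraph.components vert S =
      ∑ σ : V → Fin q, ∏ e, if e ∈ S then
        (if σ (vert (e, true)) = σ (vert (e, false)) then (1 : ℂ) else 0) else 1 := by
    intro S
    rw [RibbonGraph.components, ← Nat.cast_pow, ← card_constant_colorings,
      Nat.card_eq_fintype_card, Fintype.card_subtype, Finset.card_filter, Nat.cast_sum]
    refine Finset.sum_congr rfl fun σ _ => ?_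
    have h2 : (∀ u v, RibbonGraph.joined vert S u v → σ u = σ v) ↔
        ∀ e ∈ S, σ (vert (e, true)) = σ (vert (e, false)) := by
      constructor
      · intro h e he
        exact h _ _ ⟨e, he, rfl, rfl⟩
      · rintro h u v ⟨e, he, rfl, rfl⟩
        exact h e he
    by_cases h : ∀ e ∈ S, σ (vert (e, true)) = σ (vert (e, false))
    · rw [if_pos (h2.2 h), Nat.cast_one, Finset.prod_eq_one]
      intro e _
      split_ifs with he h3
      exacts [rfl, absurd (h e he) h3, rfl]
    · rw [if_neg (fun h' => h (h2.1 h')), Nat.cast_zero]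
      push Not at h
      obtain ⟨e, he, h⟩ := h
      rw [Finset.prod_eq_zero (Finset.mem_univ e)]
      rw [if_pos he, if_neg h]
  simp only [h1, Finset.mul_sum]
  rw [Finset.sum_comm]
  refine Finset.sum_congr rfl fun σ _ => ?_
  simp only [← Finset.prod_mul_distrib]
  simp only [add_comm (x _)]
  rw [Finset.prod_add, Finset.powerset_univ]
  refine Finset.sum_congr rfl fun S _ => ?_
  rw [← Finset.prod_mul_prod_compl S, Finset.compl_eq_univ_sdiff]
  refine congrArg₂ _ (Finset.prod_congr rfl fun e he => ?_) (Finset.prod_congr rfl fun e he => ?_)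
  · simp [he]
  · simp [(Finset.mem_sdiff.1 he).2]

/-! ### The faces of the graph of a tree diagram -/

namespace BinTree

/-- The arcs from vertices to their left neighbours are nested or have disjoint interiors: the
combinatorial form of planarity from which the face lemmas follow. -/
theorem leftNeighbour_noncrossing : ∀ (t : BinTree) {m k : ℕ}, 0 < m → m < k →
    m ≤ t.leftNeighbour k ∨ t.leftNeighbour k ≤ t.leftNeighbour m
  | leaf, _, _, _, _ => Or.inr le_rfl
  | caret l r, m, k, hm, hk => by
      rw [leftNeighbour, leftNeighbour]
      split_ifs with h1 h2 h3 h4 h5 h6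
      · exact l.leftNeighbour_noncrossing hm hk
      · omega
      · omega
      · exact Or.inr (Nat.zero_le _)
      · omega
      · exact Or.inr (Nat.zero_le _)
      · exact Or.inl (by omega)
      · exact Or.inl (by omega)
      · have := r.leftNeighbour_noncrossing (m := m - l.numLeaves) (k := k - l.numLeaves)
          (by omega) (by omega)
        omega

/-- The first leaf after the largest right subtree which starts with the leaf `m`. -/
noncomputable def branchEnd (t : BinTree) (m : ℕ) : ℕ :=
  sInf {k | m < k ∧ (t.numLeaves ≤ k ∨ t.leftNeighbour k < m)}

variable {t : BinTree} {a k m : ℕ}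

theorem branchEnd_eq (h1 : m < k) (h2 : t.numLeaves ≤ k ∨ t.leftNeighbour k < m)
    (h3 : ∀ j, m < j → j < k → j < t.numLeaves ∧ m ≤ t.leftNeighbour j) : t.branchEnd m = k := by
  refine le_antisymm (Nat.sInf_le ⟨h1, h2⟩) (le_csInf ⟨k, h1, h2⟩ ?_)
  rintro j ⟨hj, hj'⟩
  by_contra hlt
  have := h3 j hj (by omega)
  omega

theorem branchEnd_spec (hm : m < t.numLeaves) :
    m < t.branchEnd m ∧ (t.numLeaves ≤ t.branchEnd m ∨ t.leftNeighbour (t.branchEnd m) < m) ∧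
      t.branchEnd m ≤ t.numLeaves ∧
      ∀ j, m < j → j < t.branchEnd m → j < t.numLeaves ∧ m ≤ t.leftNeighbour j := by
  have hn : t.numLeaves ∈ {k | m < k ∧ (t.numLeaves ≤ k ∨ t.leftNeighbour k < m)} :=
    ⟨hm, Or.inl le_rfl⟩
  have h := Nat.sInf_mem ⟨_, hn⟩
  refine ⟨h.1, h.2, Nat.sInf_le hn, fun j h1 h2 => ?_⟩
  have := Nat.notMem_of_lt_sInf h2
  simp only [Set.mem_ofPred_eq, not_and, not_or, not_le, not_lt] at this
  exact this h1

theorem branchEnd_zero : t.branchEnd 0 = t.numLeaves :=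
  branchEnd_eq t.numLeaves_pos (Or.inl le_rfl) fun _ _ h => ⟨h, Nat.zero_le _⟩

/-- Consecutive right neighbours. -/
theorem branchEnd_of_consecutive (hk : 0 < k) (hkm : k < m) (hm : m < t.numLeaves)
    (h : t.leftNeighbour k = t.leftNeighbour m)
    (hno : ∀ j, k < j → j < m → t.leftNeighbour j ≠ t.leftNeighbour m) : t.branchEnd k = m := by
  have h0 := t.leftNeighbour_lt k hk
  refine branchEnd_eq hkm (Or.inr (h ▸ h0)) fun j h1 h2 => ⟨h2.trans hm, ?_⟩
  have h3 := t.leftNeighbour_noncrossing hk h1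
  have h4 := t.leftNeighbour_noncrossing (hk.trans h1) h2
  have h5 := hno j h1 h2
  omega

/-- The last right neighbour. -/
theorem branchEnd_of_last (hak : a < k) (hkn : k < t.numLeaves) (h : t.leftNeighbour k = a)
    (hno : ∀ j, k < j → j < t.numLeaves → t.leftNeighbour j ≠ a) :
    t.branchEnd k = t.branchEnd a := by
  obtain ⟨h1, h2, h3, h4⟩ := branchEnd_spec (hak.trans hkn)
  -- Otherwise the arc ending at `branchEnd a`, which starts before `a`, would cross the arc from
  -- `a` to `k`.
  have h5 : k < t.branchEnd a := by
    by_contra hlt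
    rcases h2 with h2 | h2
    · omega
    rcases Nat.lt_or_ge (t.branchEnd a) k with h6 | h6
    · have := t.leftNeighbour_noncrossing (by omega) h6
      omega
    · have : t.branchEnd a = k := by omega
      rw [this] at h2
      omega
  refine branchEnd_eq h5 (by omega) fun j hj hj' => ?_
  have h6 := h4 j (by omega) hj'
  have h7 := t.leftNeighbour_noncrossing (by omega) hj
  have h8 := hno j hj h6.1
  omega

/-- The first right neighbour. -/
theorem eq_succ_of_first (ham : a < m) (h : t.leftNeighbour m = a)
    (hno : ∀ j, a < j → j < m → t.leftNeighbour j ≠ a) : m = a + 1 := by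
  by_contra hne
  -- The arc ending at `a + 1` is trapped under the arc from `a` to `m`, so it starts at `a`.
  have h1 := t.leftNeighbour_noncrossing (m := a + 1) (k := m) (by omega) (by omega)
  have h2 := t.leftNeighbour_lt (a + 1) (by omega)
  have h3 := hno (a + 1) (by omega) (by omega)
  omega

theorem branchEnd_of_no_right
    (hno : ∀ j, a < j → j < t.numLeaves → t.leftNeighbour j ≠ a) : t.branchEnd a = a + 1 := by
  refine branchEnd_eq (Nat.lt_succ_self a) ?_ fun j h1 h2 => by omega
  by_contra h
  have h2 := t.leftNeighbour_lt (a + 1) (by omega)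
  have h3 := hno (a + 1) (by omega) (by omega)
  omega

theorem exists_max_right {b : ℕ} (h : ∃ j, a < j ∧ j < b ∧ t.leftNeighbour j = a) :
    ∃ j, a < j ∧ j < b ∧ t.leftNeighbour j = a ∧
      ∀ k, j < k → k < b → t.leftNeighbour k ≠ a := by
  classical
  obtain ⟨j, h1, h2, h3⟩ := h
  have hP := Nat.findGreatest_spec (P := fun j => a < j ∧ j < b ∧ t.leftNeighbour j = a)
    h2.le ⟨h1, h2, h3⟩
  refine ⟨_, hP.1, hP.2.1, hP.2.2, fun k hk hkb hka => ?_⟩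
  exact Nat.findGreatest_is_greatest hk hkb.le ⟨by have := hP.1; omega, hkb, hka⟩

theorem exists_min_right {b : ℕ} (h : ∃ j, b < j ∧ j < t.numLeaves ∧ t.leftNeighbour j = a) :
    ∃ j, b < j ∧ j < t.numLeaves ∧ t.leftNeighbour j = a ∧
      ∀ k, b < k → k < j → t.leftNeighbour k ≠ a := by
  classical
  have hP := Nat.find_spec h
  exact ⟨_, hP.1, hP.2.1, hP.2.2, fun k hk hkj hka =>
    Nat.find_min h hkj ⟨hk, hkj.trans hP.2.1, hka⟩⟩

end BinTree

/-! ### Cyclic order of the edge ends around a vertex -/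

namespace TreeDiagram

variable (D : TreeDiagram)

instance : NeZero D.n := ⟨D.bottom.numLeaves_pos.ne'⟩

theorem natCast_inj {a b : ℕ} (ha : a < D.n) (hb : b < D.n) :
    (a : ZMod D.n) = b ↔ a = b := by
  rw [ZMod.natCast_eq_natCast_iff', Nat.mod_eq_of_lt ha, Nat.mod_eq_of_lt hb]

/-- The top or the bottom tree. -/
def tree (b : Bool) : BinTree := if b then D.top else D.bottom

/-- The vertex at an end of an edge, in the numbering of the half-graph. -/
def leafOf (d : D.EdgeEnd) : ℕ :=
  if d.2 then (d.1.2 : ℕ) + 1 else (D.tree d.1.1).leftNeighbour (d.1.2 + 1)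

variable {D}

theorem leafOf_lt (d : D.EdgeEnd) : D.leafOf d < D.n := by
  obtain ⟨⟨b, i⟩, h⟩ := d
  have h1 := i.2
  have h2 := (D.tree b).leftNeighbour_lt (i + 1) (Nat.succ_pos _)
  cases h <;> simp [leafOf] <;> omega

theorem vertex_top {d : D.EdgeEnd} (hd : d.1.1 = true) :
    D.vertex d = (D.leafOf d : ZMod D.n) + D.mark := by
  obtain ⟨⟨b, i⟩, h⟩ := d
  subst hd
  rw [← Nat.cast_add]
  rfl

theorem vertex_bottom {d : D.EdgeEnd} (hd : d.1.1 = false) :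
    D.vertex d = (D.leafOf d : ZMod D.n) := by
  obtain ⟨⟨b, i⟩, h⟩ := d
  subst hd
  rfl

theorem vertex_eq_iff {d d' : D.EdgeEnd} (h : d.1.1 = d'.1.1) :
    D.vertex d = D.vertex d' ↔ D.leafOf d = D.leafOf d' := by
  cases hd : d.1.1
  · rw [vertex_bottom hd, vertex_bottom (h ▸ hd), D.natCast_inj (leafOf_lt _) (leafOf_lt _)]
  · rw [vertex_top hd, vertex_top (h ▸ hd), add_left_inj,
      D.natCast_inj (leafOf_lt _) (leafOf_lt _)]

theorem val_natCast_sub {a b : ℕ} (ha : a < D.n) (hb : b < D.n) :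
    ((a : ZMod D.n) - b).val = if b ≤ a then a - b else D.n + a - b := by
  split_ifs with h
  · rw [← Nat.cast_sub h, ZMod.val_natCast_of_lt (by omega)]
  · have : (a : ZMod D.n) - b = ((D.n + a - b : ℕ) : ZMod D.n) := by
      rw [Nat.cast_sub (by omega), Nat.cast_add, ZMod.natCast_self, zero_add]
    rw [this, ZMod.val_natCast_of_lt (by omega)]

/-- The length of an edge, in the half-graph. -/
def span (d : D.EdgeEnd) : ℕ := d.1.2 + 1 - (D.tree d.1.1).leftNeighbour (d.1.2 + 1)

theorem span_pos (d : D.EdgeEnd) : 0 < D.span d :=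
  Nat.sub_pos_of_lt ((D.tree d.1.1).leftNeighbour_lt _ (Nat.succ_pos _))

theorem span_lt (d : D.EdgeEnd) : D.span d < D.n := by
  have := d.1.2.2
  rw [span]
  omega

/-- The shift by the mark cancels in differences of vertices, so positions become plain arithmetic
in the span. Upper ends get values below `n`, lower ends values above `n`. -/
theorem position_eq (d : D.EdgeEnd) : D.position d =
    if d.1.1 then (if d.2 then D.n - D.span d else D.span d)
    else (if d.2 then D.n + D.span d else 2 * D.n - D.span d) := by
  have hval : (D.vertex (D.otherEnd d) - D.vertex d).val =
      if d.2 then D.n - D.span d else D.span d := by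
    have h1 : D.vertex (D.otherEnd d) - D.vertex d =
        (D.leafOf (D.otherEnd d) : ZMod D.n) - D.leafOf d := by
      cases hd : d.1.1
      · rw [vertex_bottom hd, vertex_bottom (d := D.otherEnd d) hd]
      · rw [vertex_top hd, vertex_top (d := D.otherEnd d) hd, add_sub_add_right_eq_sub]
    rw [h1, val_natCast_sub (leafOf_lt _) (leafOf_lt _)]
    have h2 := leafOf_lt d
    obtain ⟨⟨b, i⟩, h⟩ := d
    have h3 := (D.tree b).leftNeighbour_lt (i + 1) (Nat.succ_pos _)
    have h4 := i.2
    cases h <;> simp only [leafOf, otherEnd, span, Bool.not_true, Bool.not_false, if_true,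
      Bool.false_eq_true, if_false] at * <;> split_ifs <;> omega
  have h1 := span_lt d
  rw [position, hval]
  split_ifs <;> omega

theorem endsAt_pairwise (v : ZMod D.n) :
    (D.endsAt v).Pairwise fun d d' => D.position d ≤ D.position d' := by
  have := List.pairwise_mergeSort (le := fun d d' : D.EdgeEnd =>
    decide (D.position d ≤ D.position d')) (fun a b c h1 h2 => by
      simp only [decide_eq_true_eq] at *; omega) (fun a b => by
      simp only [Bool.or_eq_true, decide_eq_true_eq]; omega)
    ((Finset.univ : Finset D.EdgeEnd).toList.filter fun d => D.vertex d = v)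
  simpa [endsAt] using this

theorem endsAt_nodup (v : ZMod D.n) : (D.endsAt v).Nodup :=
  (List.mergeSort_perm _ _).nodup_iff.2 ((Finset.nodup_toList _).filter _)

theorem nextAround_getElem (v : ZMod D.n) (i : ℕ) (hi : i < (D.endsAt v).length) :
    D.nextAround (D.endsAt v)[i] = (D.endsAt v)[(i + 1) % (D.endsAt v).length]'
      (Nat.mod_lt _ (by omega)) := by
  have h : D.vertex (D.endsAt v)[i] = v := D.mem_endsAt.1 (List.getElem_mem hi)
  rw [nextAround]
  simp only [h]
  exact List.formPerm_apply_getElem _ (endsAt_nodup v) i hi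

/-- A criterion for the successor that hides the sorted list: every other end lies strictly before
`d` or strictly after `d'`, so ties need no separate treatment. -/
theorem nextAround_eq_of_lt {d d' : D.EdgeEnd} (hv : D.vertex d' = D.vertex d)
    (hlt : D.position d < D.position d')
    (h : ∀ x, D.vertex x = D.vertex d → x = d ∨ D.position x < D.position d ∨ x = d' ∨
      D.position d' < D.position x) : D.nextAround d = d' := by
  obtain ⟨i, hi, hdi⟩ := List.getElem_of_mem (D.mem_endsAt.2 (rfl : D.vertex d = D.vertex d))
  obtain ⟨j, hj, hdj⟩ := List.getElem_of_mem (D.mem_endsAt.2 hv)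
  have hp := List.pairwise_iff_getElem.1 (endsAt_pairwise (D.vertex d))
  have hinj : ∀ {a b : ℕ} {ha : a < (D.endsAt (D.vertex d)).length}
      {hb : b < (D.endsAt (D.vertex d)).length},
      (D.endsAt (D.vertex d))[a] = (D.endsAt (D.vertex d))[b] → a = b :=
    fun h => (endsAt_nodup (D.vertex d)).getElem_inj_iff.1 h
  have hij : i < j := by
    by_contra hji
    rcases Nat.lt_or_ge j i with h1 | h1
    · have := hp j i hj hi h1
      rw [hdi, hdj] at this
      omega
    · obtain rfl : i = j := by omega
      rw [← hdi, ← hdj] at hlt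
      exact lt_irrefl _ hlt
  have hj1 : j = i + 1 := by
    by_contra hne
    have hi1 : i + 1 < (D.endsAt (D.vertex d)).length := by omega
    have h1 := hp i (i + 1) hi hi1 (by omega)
    have h2 := hp (i + 1) j hi1 hj (by omega)
    rw [hdi] at h1
    rw [hdj] at h2
    rcases h _ (D.mem_endsAt.1 (List.getElem_mem hi1)) with h3 | h3 | h3 | h3
    · have := hinj (h3.trans hdi.symm)
      omega
    · omega
    · have := hinj (h3.trans hdj.symm)
      omega
    · omega
  have h4 := nextAround_getElem (D.vertex d) i hi
  rw [hdi] at h4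
  rw [h4, ← hdj]
  simp only [hj1]
  congr 1
  exact Nat.mod_eq_of_lt (hj1 ▸ hj)

/-- The wrap-around case, from the last end at a vertex to the first. -/
theorem nextAround_eq_of_max_of_min {d d' : D.EdgeEnd} (hv : D.vertex d' = D.vertex d)
    (hmax : ∀ x, D.vertex x = D.vertex d → x = d ∨ D.position x < D.position d)
    (hmin : ∀ x, D.vertex x = D.vertex d → x = d' ∨ D.position d' < D.position x) :
    D.nextAround d = d' := by
  obtain ⟨i, hi, hdi⟩ := List.getElem_of_mem (D.mem_endsAt.2 (rfl : D.vertex d = D.vertex d))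
  obtain ⟨j, hj, hdj⟩ := List.getElem_of_mem (D.mem_endsAt.2 hv)
  have hp := List.pairwise_iff_getElem.1 (endsAt_pairwise (D.vertex d))
  have hinj : ∀ {a b : ℕ} {ha : a < (D.endsAt (D.vertex d)).length}
      {hb : b < (D.endsAt (D.vertex d)).length},
      (D.endsAt (D.vertex d))[a] = (D.endsAt (D.vertex d))[b] → a = b :=
    fun h => (endsAt_nodup (D.vertex d)).getElem_inj_iff.1 h
  have hj0 : j = 0 := by
    by_contra hne
    have h0 : 0 < (D.endsAt (D.vertex d)).length := by omega
    have h1 := hp 0 j h0 hj (by omega)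
    rw [hdj] at h1
    rcases hmin _ (D.mem_endsAt.1 (List.getElem_mem h0)) with h3 | h3
    · have := hinj (h3.trans hdj.symm)
      omega
    · omega
  have hi1 : i + 1 = (D.endsAt (D.vertex d)).length := by
    by_contra hne
    have hi1 : i + 1 < (D.endsAt (D.vertex d)).length := by omega
    have h1 := hp i (i + 1) hi hi1 (by omega)
    rw [hdi] at h1
    rcases hmax _ (D.mem_endsAt.1 (List.getElem_mem hi1)) with h3 | h3
    · have := hinj (h3.trans hdi.symm)
      omega
    · omega
  have h4 := nextAround_getElem (D.vertex d) i hi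
  rw [hdi] at h4
  rw [h4, ← hdj]
  congr 1
  rw [hj0, hi1, Nat.mod_self]

variable (D) in
/-- The permutation `nextAround`. -/
noncomputable def rotation : Equiv.Perm D.EdgeEnd :=
  ⟨D.nextAround, D.prevAround, D.prev_next, D.next_prev⟩

/-- The rotation runs cyclically through the list of ends at a vertex, so each of them is reached
from the head of the list. -/
theorem orbit_eq_of_vertex_eq {d d' : D.EdgeEnd} (h : D.vertex d = D.vertex d') :
    Quot.mk (fun x y => y = D.rotation x) d = Quot.mk _ d' := by
  have key : ∀ (v : ZMod D.n) (i : ℕ) (hi : i < (D.endsAt v).length),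
      Quot.mk (fun x y => y = D.rotation x) ((D.endsAt v)[0]'(by omega)) =
        Quot.mk _ (D.endsAt v)[i] := by
    intro v i hi
    induction i with
    | zero => rfl
    | succ i ih =>
      rw [ih (by omega)]
      refine Quot.sound ?_
      have := nextAround_getElem v i (by omega)
      simp only [Nat.mod_eq_of_lt hi] at this
      exact this.symm
  obtain ⟨i, hi, hdi⟩ := List.getElem_of_mem (D.mem_endsAt.2 (rfl : D.vertex d = D.vertex d))
  obtain ⟨j, hj, hdj⟩ := List.getElem_of_mem (D.mem_endsAt.2 h.symm)
  rw [← hdi, ← hdj, ← key, ← key _ j]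

end TreeDiagram

/-! ### Faces and segments of the equator -/

namespace TreeDiagram

variable (D : TreeDiagram)

/-- The segment of the equator in the face at a corner, given by the vertex at its right end, in the
numbering of the half-graph. -/
noncomputable def faceLeaf (x : D.EdgeEnd × Bool) : ℕ :=
  -- The condition says that the corner lies between the edge and the equator; its region then meets
  -- the equator just left of the right end of the edge. Otherwise the region beyond the edge meets
  -- it where the branch ends. The value `n` stands for the segment left of the first vertex.
  if (x.1.2 == x.2) = x.1.1.1 then x.1.1.2 + 1 else (D.tree x.1.1.1).branchEnd (x.1.1.2 + 1)

/-- The segment of the equator in the face at a corner, given by the vertex at its right end. -/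
noncomputable def face (x : D.EdgeEnd × Bool) : ZMod D.n :=
  (D.faceLeaf x : ZMod D.n) + if x.1.1.1 then (D.mark : ZMod D.n) else 0

variable {D}

/-- The end of the edge which joins the leaf `m` to its left neighbour. -/
theorem exists_edgeEnd (b h : Bool) {m : ℕ} (h0 : 0 < m) (hm : m < D.n) :
    ∃ i : Fin (D.n - 1), (i : ℕ) + 1 = m ∧
      D.leafOf ((b, i), h) = if h then m else (D.tree b).leftNeighbour m := by
  refine ⟨⟨m - 1, by omega⟩, Nat.sub_add_cancel h0, ?_⟩
  simp [leafOf, Nat.sub_add_cancel h0]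

theorem leafOf_right (b : Bool) (i : Fin (D.n - 1)) : D.leafOf ((b, i), true) = i + 1 := rfl

theorem leafOf_left (b : Bool) (i : Fin (D.n - 1)) :
    D.leafOf ((b, i), false) = (D.tree b).leftNeighbour (i + 1) := rfl

theorem position_top_lt_bottom {d d' : D.EdgeEnd} (hd : d.1.1 = true) (hd' : d'.1.1 = false) :
    D.position d < D.position d' := by
  have h1 := span_lt d
  have h2 := span_lt d'
  have h3 := span_pos d
  have h4 := span_pos d'
  rw [position_eq, position_eq, hd, hd']
  simp only [if_true, Bool.false_eq_true, if_false]
  split_ifs <;> omega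

theorem edgeEnd_ext {b h : Bool} {i j : Fin (D.n - 1)} (hij : (i : ℕ) = j) :
    (((b, i), h) : D.EdgeEnd) = ((b, j), h) := by
  rw [Fin.ext hij]

theorem position_top_right (i : Fin (D.n - 1)) : D.position ((true, i), true) =
    D.n - (i + 1 - D.top.leftNeighbour (i + 1)) := by
  simp [position_eq, span, tree]

theorem position_top_left (i : Fin (D.n - 1)) : D.position ((true, i), false) =
    i + 1 - D.top.leftNeighbour (i + 1) := by
  simp [position_eq, span, tree]

theorem position_bottom_right (i : Fin (D.n - 1)) : D.position ((false, i), true) =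
    D.n + (i + 1 - D.bottom.leftNeighbour (i + 1)) := by
  simp [position_eq, span, tree]

theorem position_bottom_left (i : Fin (D.n - 1)) : D.position ((false, i), false) =
    2 * D.n - (i + 1 - D.bottom.leftNeighbour (i + 1)) := by
  simp [position_eq, span, tree]

/-- The corner before the first end of an edge of the top tree at a vertex. -/
theorem exists_first_top {a : ℕ} (ha : a < D.n) (hn : 1 < D.n) :
    ∃ d : D.EdgeEnd, d.1.1 = true ∧ D.leafOf d = a ∧ D.faceLeaf (d, false) = a + 1 ∧
      ∀ x : D.EdgeEnd, x.1.1 = true → D.leafOf x = a → x = d ∨ D.position d < D.position x := by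
  have hnt : D.top.numLeaves = D.n := D.numLeaves_eq
  by_cases hex : ∃ j, a < j ∧ j < D.top.numLeaves ∧ D.top.leftNeighbour j = a
  · obtain ⟨m, h1, h2, h3, h4⟩ := BinTree.exists_min_right hex
    have hm := BinTree.eq_succ_of_first h1 h3 h4
    obtain ⟨i, hi, hi'⟩ := D.exists_edgeEnd true false (by omega) (hnt ▸ h2)
    refine ⟨((true, i), false), rfl, hi'.trans h3, by simp [faceLeaf, hi, hm], ?_⟩
    rintro ⟨⟨b, j⟩, h⟩ hb hx
    obtain rfl : b = true := hb
    have hl := D.top.leftNeighbour_lt (j + 1) (Nat.succ_pos _)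
    have hj := j.2
    cases h
    · have hx' : D.top.leftNeighbour (j + 1) = a := hx
      rw [position_top_left, position_top_left, hx', hi, h3]
      by_cases hij : (i : ℕ) = j
      · exact Or.inl (edgeEnd_ext hij.symm)
      · omega
    · have hx' : (j : ℕ) + 1 = a := hx
      rw [position_top_left, position_top_right, hi, h3]
      omega
  · have hno : ∀ j, a < j → j < D.top.numLeaves → D.top.leftNeighbour j ≠ a :=
      fun j h1 h2 h3 => hex ⟨j, h1, h2, h3⟩
    -- Leaf 0 does have a right neighbour, namely leaf 1.
    have ha0 : 0 < a := by
      rcases Nat.eq_zero_or_pos a with rfl | h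
      · have := D.top.leftNeighbour_lt 1 Nat.one_pos
        exact absurd (by omega) (hno 1 Nat.one_pos (by omega))
      · exact h
    obtain ⟨i, hi, hi'⟩ := D.exists_edgeEnd true true ha0 ha
    refine ⟨((true, i), true), rfl, hi', ?_, ?_⟩
    · simp [faceLeaf, hi, tree, BinTree.branchEnd_of_no_right hno]
    · rintro ⟨⟨b, j⟩, h⟩ hb hx
      obtain rfl : b = true := hb
      have hl := D.top.leftNeighbour_lt (j + 1) (Nat.succ_pos _)
      have hj := j.2
      cases h
      · have hx' : D.top.leftNeighbour (j + 1) = a := hx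
        exact absurd hx' (hno _ (by omega) (by omega))
      · have hx' : (j : ℕ) + 1 = a := hx
        exact Or.inl (edgeEnd_ext (by omega))

/-- The corner before the first end of an edge of the bottom tree at a vertex. -/
theorem exists_first_bottom {a : ℕ} (ha : a < D.n) (hn : 1 < D.n) :
    ∃ d : D.EdgeEnd, d.1.1 = false ∧ D.leafOf d = a ∧
      (D.faceLeaf (d, false) : ZMod D.n) = a ∧
      ∀ x : D.EdgeEnd, x.1.1 = false → D.leafOf x = a → x = d ∨ D.position d < D.position x := by
  rcases Nat.eq_zero_or_pos a with rfl | ha0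
  · have hl1 := D.bottom.leftNeighbour_lt 1 Nat.one_pos
    obtain ⟨m, h1, h2, h3, h4⟩ := BinTree.exists_max_right (t := D.bottom) (a := 0) (b := D.n)
      ⟨1, Nat.one_pos, hn, by omega⟩
    obtain ⟨i, hi, hi'⟩ := D.exists_edgeEnd false false (by omega) h2
    refine ⟨((false, i), false), rfl, hi'.trans h3, ?_, ?_⟩
    -- The longest arc at the first vertex borders the outer region, with label `n`, which is 0
    -- modulo `n`.
    · simp [faceLeaf, hi, tree, BinTree.branchEnd_of_last h1 h2 h3 h4, BinTree.branchEnd_zero]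
    · rintro ⟨⟨b, j⟩, h⟩ hb hx
      obtain rfl : b = false := hb
      have hl := D.bottom.leftNeighbour_lt (j + 1) (Nat.succ_pos _)
      have hj := j.2
      cases h
      · have hx' : D.bottom.leftNeighbour (j + 1) = 0 := hx
        have h5 := h4 (j + 1)
        rw [position_bottom_left, position_bottom_left, hx', hi, h3]
        by_cases hij : (i : ℕ) = j
        · exact Or.inl (edgeEnd_ext hij.symm)
        · omega
      · exact absurd hx (Nat.succ_ne_zero _)
  · obtain ⟨i, hi, hi'⟩ := D.exists_edgeEnd false true ha0 ha
    refine ⟨((false, i), true), rfl, hi', ?_, ?_⟩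
    · simp [faceLeaf, ← hi]
    · have hla := D.bottom.leftNeighbour_lt a ha0
      rintro ⟨⟨b, j⟩, h⟩ hb hx
      obtain rfl : b = false := hb
      have hl := D.bottom.leftNeighbour_lt (j + 1) (Nat.succ_pos _)
      have hj := j.2
      cases h
      · have hx' : D.bottom.leftNeighbour (j + 1) = a := hx
        rw [position_bottom_right, position_bottom_left, hi]
        omega
      · have hx' : (j : ℕ) + 1 = a := hx
        exact Or.inl (edgeEnd_ext (by omega))

/-- The corner after an end of an edge of the top tree: either there is a next end of an edge of
the top tree, or the corner meets the segment left of the vertex. -/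
theorem next_top (d : D.EdgeEnd) (hd : d.1.1 = true) :
    (∃ d' : D.EdgeEnd, d'.1.1 = true ∧ D.leafOf d' = D.leafOf d ∧
      D.faceLeaf (d, true) = D.faceLeaf (d', false) ∧ D.position d < D.position d' ∧
      ∀ x : D.EdgeEnd, x.1.1 = true → D.leafOf x = D.leafOf d →
        x = d ∨ D.position x < D.position d ∨ x = d' ∨ D.position d' < D.position x) ∨
    ((D.faceLeaf (d, true) : ZMod D.n) = D.leafOf d ∧
      ∀ x : D.EdgeEnd, x.1.1 = true → D.leafOf x = D.leafOf d →
        x = d ∨ D.position x < D.position d) := by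
  have hnt : D.top.numLeaves = D.n := D.numLeaves_eq
  obtain ⟨⟨b, i⟩, h⟩ := d
  obtain rfl : b = true := hd
  have hi := i.2
  have hil := D.top.leftNeighbour_lt (i + 1) (Nat.succ_pos _)
  cases h
  · set a := D.top.leftNeighbour (i + 1) with ha
    have hda : D.leafOf ((true, i), false) = a := rfl
    have hface : D.faceLeaf (((true, i), false), true) = D.top.branchEnd (i + 1) := by
      simp [faceLeaf, tree]
    rw [hda, hface]
    -- In the upper hemisphere the arcs starting at `a` come by increasing length; after the longest
    -- comes the single arc ending at `a`, which is missing exactly for `a = 0`.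
    by_cases hex : ∃ j, (i : ℕ) + 1 < j ∧ j < D.top.numLeaves ∧ D.top.leftNeighbour j = a
    · obtain ⟨m, h1, h2, h3, h4⟩ := BinTree.exists_min_right hex
      have hm := BinTree.branchEnd_of_consecutive (by omega) h1 h2 (ha ▸ h3.symm)
        (fun j h5 h6 => h3.symm ▸ h4 j h5 h6)
      obtain ⟨k, hk, hk'⟩ := D.exists_edgeEnd true false (m := m) (by omega) (by omega)
      refine Or.inl ⟨((true, k), false), rfl, hk'.trans h3, ?_, ?_, ?_⟩
      · rw [hm]; simp [faceLeaf, hk]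
      · rw [position_top_left, position_top_left, hk, h3]
        omega
      · rintro ⟨⟨b, j⟩, h⟩ hb hx
        obtain rfl : b = true := hb
        have hl := D.top.leftNeighbour_lt (j + 1) (Nat.succ_pos _)
        have hj := j.2
        cases h
        · have hx' : D.top.leftNeighbour (j + 1) = a := hx
          have h5 := h4 (j + 1)
          rw [position_top_left, position_top_left, position_top_left, hx', hk, h3, ← ha]
          rcases lt_trichotomy (j : ℕ) i with h6 | h6 | h6
          · omega
          · exact Or.inl (edgeEnd_ext h6)
          · by_cases h7 : (j : ℕ) = k
            · exact Or.inr (Or.inr (Or.inl (edgeEnd_ext h7)))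
            · omega
        · have hx' : (j : ℕ) + 1 = a := hx
          rw [position_top_left, position_top_left, position_top_right, hk, h3]
          omega
    · have hno : ∀ j, (i : ℕ) + 1 < j → j < D.top.numLeaves → D.top.leftNeighbour j ≠ a :=
        fun j h1 h2 h3 => hex ⟨j, h1, h2, h3⟩
      have hb := BinTree.branchEnd_of_last hil (by omega) ha.symm hno
      rw [hb]
      rcases Nat.eq_zero_or_pos a with h0 | h0
      · refine Or.inr ⟨by simp [h0, BinTree.branchEnd_zero, hnt], ?_⟩
        rintro ⟨⟨b, j⟩, h⟩ hb hx
        obtain rfl : b = true := hb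
        have hj := j.2
        cases h
        · have hx' : D.top.leftNeighbour (j + 1) = a := hx
          have h5 := hno (j + 1)
          rw [position_top_left, position_top_left, hx', ← ha]
          by_cases hij : (j : ℕ) = i
          · exact Or.inl (edgeEnd_ext hij)
          · omega
        · have hx' : (j : ℕ) + 1 = a := hx
          omega
      · obtain ⟨k, hk, hk'⟩ := D.exists_edgeEnd true true h0 (by omega)
        have hla := D.top.leftNeighbour_lt a h0
        refine Or.inl ⟨((true, k), true), rfl, hk', ?_, ?_, ?_⟩
        · simp [faceLeaf, hk, tree]
        · rw [position_top_left, position_top_right, hk]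
          omega
        · rintro ⟨⟨b, j⟩, h⟩ hb hx
          obtain rfl : b = true := hb
          have hj := j.2
          cases h
          · have hx' : D.top.leftNeighbour (j + 1) = a := hx
            have h5 := hno (j + 1)
            rw [position_top_left, position_top_left, hx', ← ha]
            by_cases hij : (j : ℕ) = i
            · exact Or.inl (edgeEnd_ext hij)
            · omega
          · have hx' : (j : ℕ) + 1 = a := hx
            exact Or.inr (Or.inr (Or.inl (edgeEnd_ext (by omega))))
  · rw [leafOf_right]
    refine Or.inr ⟨by simp [faceLeaf], ?_⟩
    rintro ⟨⟨b, j⟩, h⟩ hb hx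
    obtain rfl : b = true := hb
    have hl := D.top.leftNeighbour_lt (j + 1) (Nat.succ_pos _)
    have hj := j.2
    cases h
    · have hx' : D.top.leftNeighbour (j + 1) = i + 1 := hx
      rw [position_top_left, position_top_right]
      omega
    · have hx' : (j : ℕ) + 1 = i + 1 := hx
      exact Or.inl (edgeEnd_ext (by omega))

/-- The corner after an end of an edge of the bottom tree: either there is a next end of an edge of
the bottom tree, or the corner meets the segment right of the vertex. -/
theorem next_bottom (d : D.EdgeEnd) (hd : d.1.1 = false) :
    (∃ d' : D.EdgeEnd, d'.1.1 = false ∧ D.leafOf d' = D.leafOf d ∧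
      D.faceLeaf (d, true) = D.faceLeaf (d', false) ∧ D.position d < D.position d' ∧
      ∀ x : D.EdgeEnd, x.1.1 = false → D.leafOf x = D.leafOf d →
        x = d ∨ D.position x < D.position d ∨ x = d' ∨ D.position d' < D.position x) ∨
    (D.faceLeaf (d, true) = D.leafOf d + 1 ∧
      ∀ x : D.EdgeEnd, x.1.1 = false → D.leafOf x = D.leafOf d →
        x = d ∨ D.position x < D.position d) := by
  have hnb : D.bottom.numLeaves = D.n := rfl
  obtain ⟨⟨b, i⟩, h⟩ := d
  obtain rfl : b = false := hd
  have hi := i.2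
  have hil := D.bottom.leftNeighbour_lt (i + 1) (Nat.succ_pos _)
  cases h
  · set a := D.bottom.leftNeighbour (i + 1) with ha
    have hda : D.leafOf ((false, i), false) = a := rfl
    have hface : D.faceLeaf (((false, i), false), true) = i + 1 := by
      simp [faceLeaf]
    rw [hda, hface]
    -- In the lower hemisphere the order is reversed: first the arc ending at `a`, then those
    -- starting there, by decreasing length.
    by_cases hex : ∃ j, a < j ∧ j < (i : ℕ) + 1 ∧ D.bottom.leftNeighbour j = a
    · obtain ⟨m, h1, h2, h3, h4⟩ := BinTree.exists_max_right hex
      have hm := BinTree.branchEnd_of_consecutive (t := D.bottom) (k := m) (m := i + 1) (by omega)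
        h2 (by omega) (h3.trans ha) (fun j h5 h6 => ha ▸ h4 j h5 h6)
      obtain ⟨k, hk, hk'⟩ := D.exists_edgeEnd false false (m := m) (by omega) (by omega)
      refine Or.inl ⟨((false, k), false), rfl, hk'.trans h3, ?_, ?_, ?_⟩
      · simp [faceLeaf, hk, tree, hm]
      · rw [position_bottom_left, position_bottom_left, hk, h3]
        omega
      · rintro ⟨⟨b, j⟩, h⟩ hb hx
        obtain rfl : b = false := hb
        have hl := D.bottom.leftNeighbour_lt (j + 1) (Nat.succ_pos _)
        have hj := j.2
        cases h
        · have hx' : D.bottom.leftNeighbour (j + 1) = a := hx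
          have h5 := h4 (j + 1)
          rw [position_bottom_left, position_bottom_left, position_bottom_left, hx', hk, h3, ← ha]
          rcases lt_trichotomy (j : ℕ) i with h6 | h6 | h6
          · by_cases h7 : (j : ℕ) = k
            · exact Or.inr (Or.inr (Or.inl (edgeEnd_ext h7)))
            · omega
          · exact Or.inl (edgeEnd_ext h6)
          · omega
        · have hx' : (j : ℕ) + 1 = a := hx
          rw [position_bottom_left, position_bottom_left, position_bottom_right, hk, h3]
          omega
    · have hno : ∀ j, a < j → j < (i : ℕ) + 1 → D.bottom.leftNeighbour j ≠ a :=
        fun j h1 h2 h3 => hex ⟨j, h1, h2, h3⟩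
      refine Or.inr ⟨BinTree.eq_succ_of_first hil ha.symm hno, ?_⟩
      rintro ⟨⟨b, j⟩, h⟩ hb hx
      obtain rfl : b = false := hb
      have hl := D.bottom.leftNeighbour_lt (j + 1) (Nat.succ_pos _)
      have hj := j.2
      cases h
      · have hx' : D.bottom.leftNeighbour (j + 1) = a := hx
        have h5 := hno (j + 1)
        rw [position_bottom_left, position_bottom_left, hx', ← ha]
        by_cases hij : (j : ℕ) = i
        · exact Or.inl (edgeEnd_ext hij)
        · omega
      · have hx' : (j : ℕ) + 1 = a := hx
        rw [position_bottom_left, position_bottom_right, ← ha]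
        omega
  · rw [leafOf_right]
    have hface : D.faceLeaf (((false, i), true), true) = D.bottom.branchEnd (i + 1) := by
      simp [faceLeaf, tree]
    rw [hface]
    by_cases hex : ∃ j, (i : ℕ) + 1 < j ∧ j < D.n ∧ D.bottom.leftNeighbour j = i + 1
    · obtain ⟨m, h1, h2, h3, h4⟩ := BinTree.exists_max_right hex
      obtain ⟨k, hk, hk'⟩ := D.exists_edgeEnd false false (m := m) (by omega) (by omega)
      refine Or.inl ⟨((false, k), false), rfl, hk'.trans h3, ?_, ?_, ?_⟩
      · simp [faceLeaf, hk, tree, BinTree.branchEnd_of_last h1 h2 h3 h4]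
      · rw [position_bottom_left, position_bottom_right, hk, h3]
        omega
      · rintro ⟨⟨b, j⟩, h⟩ hb hx
        obtain rfl : b = false := hb
        have hl := D.bottom.leftNeighbour_lt (j + 1) (Nat.succ_pos _)
        have hj := j.2
        cases h
        · have hx' : D.bottom.leftNeighbour (j + 1) = i + 1 := hx
          have h5 := h4 (j + 1)
          rw [position_bottom_left, position_bottom_right, position_bottom_left, hx', hk, h3]
          by_cases h7 : (j : ℕ) = k
          · exact Or.inr (Or.inr (Or.inl (edgeEnd_ext h7)))
          · omega
        · have hx' : (j : ℕ) + 1 = i + 1 := hx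
          exact Or.inl (edgeEnd_ext (by omega))
    · have hno : ∀ j, (i : ℕ) + 1 < j → j < D.n → D.bottom.leftNeighbour j ≠ i + 1 :=
        fun j h1 h2 h3 => hex ⟨j, h1, h2, h3⟩
      refine Or.inr ⟨BinTree.branchEnd_of_no_right hno, ?_⟩
      rintro ⟨⟨b, j⟩, h⟩ hb hx
      obtain rfl : b = false := hb
      have hl := D.bottom.leftNeighbour_lt (j + 1) (Nat.succ_pos _)
      have hj := j.2
      cases h
      · have hx' : D.bottom.leftNeighbour (j + 1) = i + 1 := hx
        exact absurd hx' (hno _ (by omega) (by omega))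
      · have hx' : (j : ℕ) + 1 = i + 1 := hx
        exact Or.inl (edgeEnd_ext (by omega))

theorem exists_leaf_top (v : ZMod D.n) : ∃ a < D.n, (a : ZMod D.n) + D.mark = v :=
  ⟨(v - D.mark).val, ZMod.val_lt _, by rw [ZMod.natCast_zmod_val, sub_add_cancel]⟩

theorem exists_leaf_bottom (v : ZMod D.n) : ∃ a < D.n, (a : ZMod D.n) = v :=
  ⟨v.val, ZMod.val_lt _, ZMod.natCast_zmod_val v⟩

/-- Consecutive ends in one hemisphere bound a common region. When the rotation passes from one
hemisphere to the other, both corners meet the same segment of the equator next to the vertex. -/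
theorem face_nextAround (d : D.EdgeEnd) : D.face (D.nextAround d, false) = D.face (d, true) := by
  have hn : 1 < D.n := by have := d.1.2.2; omega
  have hbool : ∀ b : Bool, b ≠ true → b = false := fun b => by simp
  cases hd : d.1.1
  · have hside : ∀ x : D.EdgeEnd, x.1.1 = false → D.vertex x = D.vertex d →
        D.leafOf x = D.leafOf d := fun x hx hv => (vertex_eq_iff (hx.trans hd.symm)).1 hv
    rcases next_bottom d hd with ⟨d', h1, h2, h3, h4, h5⟩ | ⟨h1, h2⟩
    · rw [nextAround_eq_of_lt ((vertex_eq_iff (h1.trans hd.symm)).2 h2) h4, face, face]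
      · simp [h1, hd, h3]
      · intro x hx
        by_cases hxb : x.1.1 = true
        · exact Or.inr (Or.inl (position_top_lt_bottom hxb hd))
        · exact h5 x (hbool _ hxb) (hside x (hbool _ hxb) hx)
    · obtain ⟨a, ha, hav⟩ := exists_leaf_top (D.vertex d)
      obtain ⟨d', g1, g2, g3, g4⟩ := exists_first_top ha hn
      have hv' : D.vertex d' = D.vertex d := by rw [vertex_top g1, g2, hav]
      rw [nextAround_eq_of_max_of_min hv', face, face]
      · rw [vertex_bottom hd] at hav
        simp only [g1, hd, h1, g3, if_true, Bool.false_eq_true, if_false, Nat.cast_add,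
          Nat.cast_one, ← hav]
        ring
      · intro x hx
        by_cases hxb : x.1.1 = true
        · exact Or.inr (position_top_lt_bottom hxb hd)
        · exact h2 x (hbool _ hxb) (hside x (hbool _ hxb) hx)
      · intro x hx
        by_cases hxb : x.1.1 = true
        · exact g4 x hxb (((vertex_eq_iff (hxb.trans g1.symm)).1 (hx.trans hv'.symm)).trans g2)
        · exact Or.inr (position_top_lt_bottom g1 (hbool _ hxb))
  · have hside : ∀ x : D.EdgeEnd, x.1.1 = true → D.vertex x = D.vertex d →
        D.leafOf x = D.leafOf d := fun x hx hv => (vertex_eq_iff (hx.trans hd.symm)).1 hv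
    rcases next_top d hd with ⟨d', h1, h2, h3, h4, h5⟩ | ⟨h1, h2⟩
    · rw [nextAround_eq_of_lt ((vertex_eq_iff (h1.trans hd.symm)).2 h2) h4, face, face]
      · simp [h1, hd, h3]
      · intro x hx
        by_cases hxb : x.1.1 = true
        · exact h5 x hxb (hside x hxb hx)
        · exact Or.inr (Or.inr (Or.inr (position_top_lt_bottom h1 (hbool _ hxb))))
    · obtain ⟨a, ha, hav⟩ := exists_leaf_bottom (D.vertex d)
      obtain ⟨d', g1, g2, g3, g4⟩ := exists_first_bottom ha hn
      have hv' : D.vertex d' = D.vertex d := by rw [vertex_bottom g1, g2, hav]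
      rw [nextAround_eq_of_lt hv' (position_top_lt_bottom hd g1), face, face]
      · rw [vertex_top hd] at hav
        simp only [g1, hd, h1, g3, if_true, Bool.false_eq_true, if_false, hav, add_zero]
      · intro x hx
        by_cases hxb : x.1.1 = true
        · rcases h2 x hxb (hside x hxb hx) with h | h
          exacts [Or.inl h, Or.inr (Or.inl h)]
        · exact Or.inr (Or.inr (g4 x (hbool _ hxb)
            (((vertex_eq_iff ((hbool _ hxb).trans g1.symm)).1 (hx.trans hv'.symm)).trans g2)))

theorem face_otherEnd (d : D.EdgeEnd) : D.face (D.otherEnd d, true) = D.face (d, false) := by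
  obtain ⟨⟨b, i⟩, h⟩ := d
  cases h <;> cases b <;> rfl

/-- The segment left of a top leaf other than the first lies under the arc ending there; the
remaining segment belongs to the outer side of the longest arc at the first leaf. -/
theorem exists_face_eq (hn : 1 < D.n) (v : ZMod D.n) : ∃ d, D.face (d, true) = v := by
  obtain ⟨a, ha, rfl⟩ := exists_leaf_top v
  have hl := D.top.leftNeighbour_lt 1 Nat.one_pos
  rcases Nat.eq_zero_or_pos a with rfl | h0
  · obtain ⟨m, h1, h2, h3, h4⟩ := BinTree.exists_max_right (t := D.top) (a := 0)
      (b := D.top.numLeaves) ⟨1, Nat.one_pos, D.numLeaves_eq ▸ hn, by omega⟩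
    obtain ⟨i, hi, -⟩ := D.exists_edgeEnd true false h1 (h2.trans_eq D.numLeaves_eq)
    refine ⟨((true, i), false), ?_⟩
    simp [face, faceLeaf, hi, tree, BinTree.branchEnd_of_last h1 h2 h3 h4, BinTree.branchEnd_zero,
      D.numLeaves_eq]
  · obtain ⟨i, hi, -⟩ := D.exists_edgeEnd true true h0 ha
    exact ⟨((true, i), true), by simp [face, faceLeaf, ← hi]⟩

/-- The bottom half-graph alone is connected, since repeated passage to left neighbours leads to 0.
-/
theorem components_univ_le :
    RibbonGraph.components D.vertex (Finset.univ : Finset D.Edge) ≤ 1 := by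
  have key : ∀ a : ℕ, a < D.n →
      Quot.mk (RibbonGraph.joined D.vertex Finset.univ) (a : ZMod D.n) = Quot.mk _ 0 := by
    intro a
    induction a using Nat.strong_induction_on with
    | _ a ih =>
      intro ha
      rcases Nat.eq_zero_or_pos a with rfl | h0
      · rw [Nat.cast_zero]
      · have hl := D.bottom.leftNeighbour_lt a h0
        rw [← ih _ hl (hl.trans ha)]
        obtain ⟨i, hi, -⟩ := D.exists_edgeEnd false true h0 ha
        refine Quot.sound ⟨(false, i), Finset.mem_univ _, ?_, ?_⟩
        · rw [vertex_bottom rfl, leafOf_right, hi]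
        · rw [vertex_bottom rfl, leafOf_left, hi]
          rfl
  rw [RibbonGraph.components, Finite.card_le_one_iff_subsingleton]
  refine ⟨?_⟩
  rintro ⟨u⟩ ⟨v⟩
  obtain ⟨a, ha, rfl⟩ := exists_leaf_bottom u
  obtain ⟨b, hb, rfl⟩ := exists_leaf_bottom v
  exact (key a ha).trans (key b hb).symm

/-- `face` is constant along boundary walks and takes all `n` segments as values. The lower bound
suffices for `boundaries_add_card`. -/
theorem le_boundaries_univ (hn : 1 < D.n) :
    D.n ≤ RibbonGraph.boundaries D.rotation (Finset.univ : Finset D.Edge) := by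
  have h : ∀ x y : D.EdgeEnd, y = (RibbonGraph.flip (Finset.univ : Finset D.Edge) * D.rotation) x →
      D.face (x, true) = D.face (y, true) := by
    rintro x _ rfl
    have : (RibbonGraph.flip (Finset.univ : Finset D.Edge) * D.rotation) x = D.otherEnd (D.nextAround x) := by
      simp [RibbonGraph.flip_apply, rotation, otherEnd]
    rw [this, face_otherEnd, face_nextAround]
  have hs : Function.Surjective (Quot.lift (fun d => D.face (d, true)) h) := fun v => by
    obtain ⟨d, hd⟩ := exists_face_eq hn v
    exact ⟨Quot.mk _ d, hd⟩
  have := Nat.card_le_card_of_surjective _ hs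
  rwa [Nat.card_zmod] at this

/-- Euler's formula for the subgraphs of the plane graph of a tree diagram. -/
theorem boundaries_add_n (hn : 1 < D.n) (S : Finset D.Edge) :
    RibbonGraph.boundaries D.rotation S + D.n =
      2 * RibbonGraph.components D.vertex S + S.card := by
  have := RibbonGraph.boundaries_add_card (vert := D.vertex) (ν := D.rotation)
    D.vertex_nextAround (fun d d' => orbit_eq_of_vertex_eq) components_univ_le
    -- The face count of the sphere: `n` vertices, `2 (n - 1)` edges, at least `n` faces.
    (by
      have := le_boundaries_univ hn
      rw [Nat.card_zmod, Fintype.card_prod, Fintype.card_bool, Fintype.card_fin]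
      omega) S
  rwa [Nat.card_zmod] at this

end TreeDiagram

/-! ### The Jones polynomial as a partition function -/

namespace BinTree

/-- The Boltzmann weight of a colouring of the vertices of the half-graph of a tree. -/
def weight {C R : Type*} [CommRing R] (w : C → C → R) : BinTree → (ℕ → C) → R
  | leaf, _ => 1
  | caret l r, f =>
      l.weight w f * r.weight w (fun k => f (l.numLeaves + k)) * w (f 0) (f l.numLeaves)

variable {C R : Type*} [CommRing R] (w : C → C → R)

theorem weight_congr : ∀ (t : BinTree) {f g : ℕ → C}, (∀ k < t.numLeaves, f k = g k) →
    t.weight w f = t.weight w g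
  | leaf, _, _, _ => rfl
  | caret l r, f, g, h => by
      have hl := l.numLeaves_pos
      have hr := r.numLeaves_pos
      have h' : ∀ k < l.numLeaves + r.numLeaves, f k = g k := h
      rw [weight, weight, l.weight_congr fun k hk => h' k (by omega),
        r.weight_congr fun k hk => h' (l.numLeaves + k) (by omega), h' 0 (by omega),
        h' l.numLeaves (by omega)]

theorem weight_eq_prod : ∀ (t : BinTree) (f : ℕ → C), t.weight w f =
    ∏ i ∈ Finset.range (t.numLeaves - 1), w (f (t.leftNeighbour (i + 1))) (f (i + 1))
  | leaf, _ => rfl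
  | caret l r, f => by
      have hl := l.numLeaves_pos
      have hr := r.numLeaves_pos
      have hn : (caret l r).numLeaves - 1 = l.numLeaves - 1 + 1 + (r.numLeaves - 1) := by
        rw [numLeaves]; omega
      rw [weight, weight_eq_prod l, weight_eq_prod r, hn, Finset.prod_range_add,
        Finset.prod_range_succ, mul_right_comm]
      congr 1
      · congr 1
        · refine Finset.prod_congr rfl fun i hi => ?_
          have := Finset.mem_range.1 hi
          rw [leftNeighbour, if_pos (by omega)]
        · rw [Nat.sub_add_cancel hl, leftNeighbour, if_neg (lt_irrefl _), if_pos rfl]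
      · refine Finset.prod_congr rfl fun i _ => ?_
        rw [Nat.sub_add_cancel hl, leftNeighbour, if_neg (by omega), if_neg (by omega),
          show l.numLeaves + i + 1 - l.numLeaves = i + 1 by omega, add_assoc]

end BinTree

/-! ### From the state sum of the link to the Potts model -/

namespace TreeDiagram

variable {D : TreeDiagram}

variable (D) in
/-- The partition function of the graph of a tree diagram. -/
def partitionFunction {C R : Type*} [Fintype C] [CommRing R] (w w' : C → C → R) : R :=
  ∑ σ : ZMod D.n → C, D.top.weight w (fun k => σ ((k : ZMod D.n) + D.mark)) *
    D.bottom.weight w' (fun k => σ k)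

/-- The Potts weight. -/
def pottsWeight {C R : Type*} [DecidableEq C] [CommRing R] (x : R) (a b : C) : R :=
  if a = b then x else 1

theorem partitionFunction_potts {C R : Type*} [Fintype C] [DecidableEq C] [CommRing R] (x y : R) :
    D.partitionFunction (pottsWeight (C := C) x) (pottsWeight y) =
      ∑ σ : ZMod D.n → C, ∏ e : D.Edge,
        if σ (D.vertex (e, true)) = σ (D.vertex (e, false)) then (if e.1 then x else y) else 1 := by
  refine Finset.sum_congr rfl fun σ _ => ?_
  rw [Fintype.prod_prod_type, Fintype.prod_bool, BinTree.weight_eq_prod, BinTree.weight_eq_prod,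
    D.numLeaves_eq, Finset.prod_range, Finset.prod_range]
  congr 1
  · refine Finset.prod_congr rfl fun i _ => ?_
    rw [vertex_top rfl, vertex_top rfl, leafOf_right, leafOf_left, pottsWeight]
    exact if_congr eq_comm rfl rfl
  · refine Finset.prod_congr rfl fun i _ => ?_
    rw [vertex_bottom rfl, vertex_bottom rfl, leafOf_right, leafOf_left, pottsWeight]
    exact if_congr eq_comm rfl rfl

variable (D) in
/-- The edges along which a state joins the black regions. -/
def joinedEdges (s : D.Edge → Bool) : Finset D.Edge := Finset.univ.filter fun e => s e ≠ e.1

variable (D) in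
/-- The arcs of the link, on the half-edges of the edges of the graph. -/
noncomputable def linkArc : D.Edge × Fin 4 → D.Edge × Fin 4 := D.link.arc

variable (D) in
/-- The smoothings of the link, on the half-edges of the edges of the graph. -/
noncomputable def linkSmooth (s : D.Edge → Bool) : D.Edge × Fin 4 → D.Edge × Fin 4 :=
  D.link.smooth s

variable (D) in
/-- The relation whose classes are the loops of a state. -/
def linkStep (s : D.Edge → Bool) (h h' : D.Edge × Fin 4) : Prop :=
  h' = D.linkArc h ∨ h' = D.linkSmooth s h

variable (D) in
/-- The number of loops of a state of the link. -/
noncomputable def linkLoops (s : D.Edge → Bool) : ℕ :=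
  Nat.card (Quot (D.linkStep s)) + Nat.card {v : ZMod D.n // ∀ d, D.vertex d ≠ v}

theorem kauffmanBracket_link (A : ℂ) : D.link.kauffmanBracket A =
    ∑ s : D.Edge → Bool, A ^ (∑ e : D.Edge, if s e then (1 : ℤ) else -1) *
      (-A ^ 2 - A ^ (-2 : ℤ)) ^ (D.linkLoops s - 1) := rfl

/-- The `A`-smoothing separates the black regions at an upper edge and joins them at a lower one. A
strand passes to the other end of the edge if they are joined, and to the opposite corner of the
same end if not; in both cases the side label changes. -/
theorem corner_smooth (s : D.Edge → Bool) (h : D.Edge × Fin 4) :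
    D.corner (D.linkSmooth s h) =
      (RibbonGraph.flip (D.joinedEdges s) (D.corner h).1, !(D.corner h).2) := by
  obtain ⟨⟨b, i⟩, k⟩ := h
  have key : ∀ a : Bool, s (b, i) = a → D.corner (D.linkSmooth s ((b, i), k)) =
      (RibbonGraph.flip (D.joinedEdges s) (D.corner ((b, i), k)).1, !(D.corner ((b, i), k)).2) := by
    intro a ha
    cases b <;> cases a <;> fin_cases k <;>
      simp [linkSmooth, LinkDiagram.smooth, corner, RibbonGraph.flip_apply, joinedEdges, ha]
  exact key _ rfl

theorem corner_arc (h : D.Edge × Fin 4) : D.corner (D.linkArc h) = D.cornerArc (D.corner h) :=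
  D.corner.apply_symm_apply _

/-- The loops of a state bound the black surface: an arc followed by a smoothing takes `(d, true)`
to the `true` corner at the next end on the boundary walk. -/
theorem card_loops (s : D.Edge → Bool) :
    Nat.card (Quot (D.linkStep s)) =
      RibbonGraph.boundaries D.rotation (D.joinedEdges s) := by
  set τ := RibbonGraph.flip (D.joinedEdges s) with hτ
  have hττ : ∀ d, τ (τ d) = d := τ.left_inv
  let r : D.EdgeEnd → D.EdgeEnd → Prop := fun x y => y = (τ * D.rotation) x
  -- A `false` corner lies on the same loop as the `true` corner at the other end of its arc, which
  -- is that of the preceding edge end.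
  let φ : D.EdgeEnd × Bool → Quot r := fun x => Quot.mk r (if x.2 then x.1 else D.prevAround x.1)
  have hφ : ∀ h h' : D.Edge × Fin 4, D.linkStep s h h' →
      φ (D.corner h) = φ (D.corner h') := by
    rintro h _ (rfl | rfl)
    · rw [corner_arc]
      generalize D.corner h = x
      obtain ⟨d, a⟩ := x
      cases a
      · rfl
      · simp [φ, cornerArc, prev_next]
    · rw [corner_smooth, ← hτ]
      generalize D.corner h = x
      obtain ⟨d, a⟩ := x
      cases a
      · refine Quot.sound ?_
        change τ d = τ (D.nextAround (D.prevAround d))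
        rw [next_prev]
      · refine (Quot.sound ?_).symm
        change d = τ (D.nextAround (D.prevAround (τ d)))
        rw [next_prev, hττ]
  have hψ : ∀ d d', r d d' → Quot.mk (D.linkStep s) (D.corner.symm (d, true)) =
        Quot.mk _ (D.corner.symm (d', true)) := by
    rintro d _ rfl
    refine (Quot.sound (b := D.corner.symm (D.nextAround d, false)) (Or.inl ?_)).trans
      (Quot.sound (Or.inr ?_))
    · rw [Equiv.symm_apply_eq, corner_arc, Equiv.apply_symm_apply]
      rfl
    · rw [Equiv.symm_apply_eq, corner_smooth, Equiv.apply_symm_apply]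
      rfl
  refine Nat.card_congr
    { toFun := Quot.lift (fun h => φ (D.corner h)) hφ
      invFun := Quot.lift (fun d => Quot.mk _ (D.corner.symm (d, true))) hψ
      left_inv := ?_
      right_inv := ?_ }
  · rintro ⟨h⟩
    obtain ⟨⟨d, a⟩, rfl⟩ := D.corner.symm.surjective h
    change Quot.mk (D.linkStep s) (D.corner.symm (if (D.corner (D.corner.symm (d, a))).2 then
      (D.corner (D.corner.symm (d, a))).1 else
        D.prevAround (D.corner (D.corner.symm (d, a))).1, true)) = Quot.mk _ _
    rw [Equiv.apply_symm_apply]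
    cases a
    · refine (Quot.sound (r := D.linkStep s) (Or.inl ?_)).symm
      rw [Equiv.symm_apply_eq, corner_arc, Equiv.apply_symm_apply]
      rfl
    · rfl
  · rintro ⟨d⟩
    change φ (D.corner (D.corner.symm (d, true))) = _
    rw [Equiv.apply_symm_apply]
    rfl

theorem card_isolated (hn : 1 < D.n) : Nat.card {v : ZMod D.n // ∀ d, D.vertex d ≠ v} = 0 := by
  rw [Nat.card_eq_zero]
  refine Or.inl ⟨fun ⟨v, hv⟩ => ?_⟩
  obtain ⟨a, ha, rfl⟩ := exists_leaf_bottom v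
  obtain ⟨d, h1, h2, -⟩ := exists_first_bottom ha hn
  exact hv d (by rw [vertex_bottom h1, h2])

/-- The number of loops of a state of the link of a tree diagram. -/
theorem loops_add_n (s : D.Edge → Bool) : D.linkLoops s + D.n =
    2 * RibbonGraph.components D.vertex (D.joinedEdges s) + (D.joinedEdges s).card := by
  by_cases hn : 1 < D.n
  · rw [← boundaries_add_n hn, ← card_loops, linkLoops, card_isolated hn, add_zero]
  -- With a single leaf there are no crossings, and the isolated vertex supplies the one loop.
  · have hn1 : D.n = 1 := le_antisymm (not_lt.1 hn) D.bottom.numLeaves_pos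
    have hE : IsEmpty D.Edge := ⟨fun e => by have := e.2.2; omega⟩
    have hS : D.joinedEdges s = ∅ := Finset.eq_empty_of_isEmpty _
    have hQ : IsEmpty (Quot (D.linkStep s)) := ⟨by rintro ⟨h⟩; exact hE.elim h.1⟩
    rw [hS, RibbonGraph.components_empty, linkLoops, Nat.card_of_isEmpty,
      Nat.card_congr (Equiv.subtypeUnivEquiv fun v d => hE.elim d.1), Nat.card_zmod,
      Finset.card_empty]
    omega

/-- Makes the truncated exponent `loops s - 1` of the bracket an honest difference. -/
theorem loops_pos (s : D.Edge → Bool) : 0 < D.linkLoops s := by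
  by_cases hn : 1 < D.n
  · have hne : Nonempty (D.Edge × Fin 4) := ⟨((true, ⟨0, by omega⟩), 0)⟩
    have : Nonempty (Quot (D.linkStep s)) := hne.map (Quot.mk _)
    exact Nat.add_pos_left Nat.card_pos _
  · have hn1 : D.n = 1 := le_antisymm (not_lt.1 hn) D.bottom.numLeaves_pos
    have hE : IsEmpty D.Edge := ⟨fun e => by have := e.2.2; omega⟩
    have h := loops_add_n s
    have hS : D.joinedEdges s = ∅ := Finset.eq_empty_of_isEmpty _
    rw [hS, RibbonGraph.components_empty, Nat.card_zmod] at h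
    omega

/-- The `n - 1` positive crossings on upper edges cancel the `n - 1` negative ones on lower edges.
-/
theorem writhe_orientation (σ : D.graph.Coloring Bool) : (D.orientation σ).writhe = 0 := by
  have hsign : ∀ e : D.Edge, (D.orientation σ).sign e = if e.1 then 1 else -1 := by
    rintro ⟨b, i⟩
    have := D.coloring_ne σ (b, i)
    cases b <;> simp [LinkDiagram.Orientation.sign, orientation, corner, this]
  have h : (D.orientation σ).writhe = ∑ e : D.Edge, if e.1 then (1 : ℤ) else -1 :=
    Finset.sum_congr rfl fun e _ => hsign e
  rw [h, Fintype.sum_prod_type]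
  simp

theorem joinedEdges_bijective : Function.Bijective (D.joinedEdges) := by
  constructor
  · intro s s' h
    funext e
    have := congrArg (e ∈ ·) h
    simp only [joinedEdges, Finset.mem_filter, Finset.mem_univ, true_and] at this
    revert this
    cases s e <;> cases s' e <;> cases e.1 <;> simp
  · intro S
    refine ⟨fun e => xor e.1 (decide (e ∈ S)), ?_⟩
    ext e
    by_cases h : e ∈ S <;> simp [joinedEdges, h]

/-- The normalised Jones polynomial of the link of a tree diagram as a partition function of the
Potts model with `q = t + 2 + t⁻¹` colours. -/
theorem jonesValue_eq {t A : ℂ} {q : ℕ} (hq : q ≠ 0) (ht : t ≠ 0) (hqt : (q : ℂ) = t + 2 + t⁻¹)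
    (hA : A ^ (-4 : ℤ) = t) (σ : D.graph.Coloring Bool) :
    D.jonesValue σ A = ((q : ℂ) ^ D.n)⁻¹ *
      D.partitionFunction (pottsWeight (C := Fin q) (-t)) (pottsWeight (-t⁻¹)) := by
  have hA0 : A ≠ 0 := by
    rintro rfl
    exact ht (by rw [← hA, zero_zpow _ (by norm_num)])
  have hA4 : A ^ 4 = t⁻¹ := by
    rw [← hA, zpow_neg, inv_inv]
    norm_cast
  set d : ℂ := -A ^ 2 - A ^ (-2 : ℤ) with hd
  have hA2 : A ^ (-2 : ℤ) = (A ^ 2)⁻¹ := by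
    rw [zpow_neg]
    norm_cast
  have hdd : d ^ 2 = q := by
    have : t = (A ^ 4)⁻¹ := by rw [hA4, inv_inv]
    rw [hqt, ← hA4, this, hd, hA2]
    field_simp
    ring
  have hq0 : (q : ℂ) ≠ 0 := Nat.cast_ne_zero.2 hq
  have hd0 : d ≠ 0 := by
    rintro h0
    exact hq0 (by rw [← hdd, h0]; norm_num)
  -- A joined upper edge contributes `A⁻¹ d`, a separated one `A`. On equal colours the two add up
  -- to `-t` times the weight `A` of unequal colours; `hAd'` is the mirror statement for lower
  -- edges.
  have hAd : A⁻¹ * d = -A - A * t := by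
    have : t = (A ^ 4)⁻¹ := by rw [hA4, inv_inv]
    rw [this, hd, hA2]
    field_simp
  have hAd' : A * d = -A⁻¹ - A⁻¹ * t⁻¹ := by
    rw [← hA4, hd, hA2]
    field_simp
    ring
  have hterm : ∀ s : D.Edge → Bool,
      A ^ (∑ e : D.Edge, if s e then (1 : ℤ) else -1) * d ^ (D.linkLoops s - 1) *
        d ^ (-(D.n : ℤ) + 1) = ((q : ℂ) ^ D.n)⁻¹ *
          ((∏ e : D.Edge, if e ∈ D.joinedEdges s then (if e.1 then A⁻¹ * d else A * d)
            else (if e.1 then A else A⁻¹)) *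
              (q : ℂ) ^ RibbonGraph.components D.vertex (D.joinedEdges s)) := by
    intro s
    have h1 : A ^ (∑ e : D.Edge, if s e then (1 : ℤ) else -1) * d ^ (D.joinedEdges s).card =
        ∏ e : D.Edge, if e ∈ D.joinedEdges s then (if e.1 then A⁻¹ * d else A * d)
            else (if e.1 then A else A⁻¹) := by
      have hsum : ∀ T : Finset D.Edge, A ^ (∑ e ∈ T, if s e then (1 : ℤ) else -1) =
          ∏ e ∈ T, A ^ (if s e then (1 : ℤ) else -1) := by
        intro T
        induction T using Finset.induction_on with
        | empty => simp
        | insert e T he ih => rw [Finset.sum_insert he, Finset.prod_insert he, zpow_add₀ hA0, ih]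
      rw [← Finset.prod_const, hsum, ← Fintype.prod_ite_mem (D.joinedEdges s), ← Finset.prod_mul_distrib]
      refine Finset.prod_congr rfl fun e _ => ?_
      have he : e ∈ D.joinedEdges s ↔ s e ≠ e.1 := by simp [joinedEdges]
      simp only [he]
      cases s e <;> cases e.1 <;> simp
    have h2 : (D.linkLoops s : ℤ) + D.n =
        2 * RibbonGraph.components D.vertex (D.joinedEdges s) + (D.joinedEdges s).card := by
      exact_mod_cast loops_add_n s
    have h3 : d ^ (D.linkLoops s - 1) * d ^ (-(D.n : ℤ) + 1) = ((q : ℂ) ^ D.n)⁻¹ *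
        (d ^ (D.joinedEdges s).card *
          (q : ℂ) ^ RibbonGraph.components D.vertex (D.joinedEdges s)) := by
      rw [← hdd, ← pow_mul, ← pow_mul, ← zpow_natCast, ← zpow_natCast, ← zpow_natCast,
        ← zpow_natCast, ← zpow_neg, ← zpow_add₀ hd0, ← zpow_add₀ hd0, ← zpow_add₀ hd0]
      congr 1
      have := loops_pos s
      push_cast [Nat.cast_sub this]
      linarith
    rw [mul_assoc, h3, ← h1]
    ring
  rw [jonesValue, LinkDiagram.Orientation.jones, writhe_orientation, neg_zero, zpow_zero, one_mul,
    kauffmanBracket_link, Finset.sum_mul]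
  refine (Finset.sum_congr rfl fun s _ => hterm s).trans ?_
  rw [← Finset.mul_sum, joinedEdges_bijective.sum_comp (fun S : Finset D.Edge =>
    (∏ e : D.Edge, if e ∈ S then (if e.1 then A⁻¹ * d else A * d) else (if e.1 then A else A⁻¹)) *
      (q : ℂ) ^ RibbonGraph.components D.vertex S), fortuin_kasteleyn, partitionFunction_potts]
  congr 1
  refine Finset.sum_congr rfl fun σ _ => ?_
  -- Taking the weight of unequal colours out of every edge removes the last dependence on the root
  -- `A`.
  have hprod : ∏ e : D.Edge, (if e.1 then A else A⁻¹) = 1 := by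
    rw [Fintype.prod_prod_type, Fintype.prod_bool]
    simp [hA0]
  refine Eq.trans (b := (∏ e : D.Edge, (if e.1 then A else A⁻¹)) * ∏ e : D.Edge,
    if σ (D.vertex (e, true)) = σ (D.vertex (e, false)) then (if e.1 then -t else -t⁻¹) else 1)
    ?_ (by rw [hprod, one_mul])
  rw [← Finset.prod_mul_distrib]
  refine Finset.prod_congr rfl fun e _ => ?_
  split_ifs
  · rw [hAd]; ring
  · ring
  · rw [hAd']; ring
  · ring

end TreeDiagram

/-! ### Splitting leaves -/

/-- The increasing map `ℕ → ℕ` whose range misses `p`. -/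
def skip (p k : ℕ) : ℕ := if k < p then k else k + 1

namespace BinTree

/-- Attach a caret to the `i`-th leaf. -/
def splitLeaf : BinTree → ℕ → BinTree
  | leaf, _ => caret leaf leaf
  | caret l r, i =>
      if i < l.numLeaves then caret (l.splitLeaf i) r else caret l (r.splitLeaf (i - l.numLeaves))

theorem numLeaves_splitLeaf : ∀ (t : BinTree) (i : ℕ),
    (t.splitLeaf i).numLeaves = t.numLeaves + 1
  | leaf, _ => rfl
  | caret l r, i => by
      rw [splitLeaf]
      split_ifs
      · rw [numLeaves, l.numLeaves_splitLeaf, numLeaves]; omega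
      · rw [numLeaves, r.numLeaves_splitLeaf, numLeaves]; omega

/-- Of the two leaves replacing leaf `i`, the left one keeps the number `i` and the left endpoint,
the right one is new and gets `i + 1`; `skip (i + 1)` renumbers the old leaves. -/
theorem leafStart_splitLeaf_skip : ∀ (t : BinTree) {i k : ℕ}, i < t.numLeaves → k < t.numLeaves →
    (t.splitLeaf i).leafStart (skip (i + 1) k) = t.leafStart k
  | leaf, i, k, hi, hk => by
      obtain rfl : i = 0 := Nat.lt_one_iff.1 hi
      obtain rfl : k = 0 := Nat.lt_one_iff.1 hk
      simp [splitLeaf, leafStart, skip, numLeaves]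
  | caret l r, i, k, hi, hk => by
      rw [numLeaves] at hi hk
      rw [splitLeaf]
      by_cases h : i < l.numLeaves
      · rw [if_pos h, leafStart, leafStart, numLeaves_splitLeaf]
        by_cases h' : k < l.numLeaves
        · rw [if_pos h', if_pos (by rw [skip]; split_ifs <;> omega),
            l.leafStart_splitLeaf_skip h h']
        · rw [if_neg h', if_neg (by rw [skip]; split_ifs <;> omega)]
          rw [show skip (i + 1) k - (l.numLeaves + 1) = k - l.numLeaves by
            rw [skip]; split_ifs <;> omega]
      · rw [if_neg h, leafStart, leafStart]
        by_cases h' : k < l.numLeaves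
        · rw [if_pos h', show skip (i + 1) k = k by rw [skip]; split_ifs <;> omega, if_pos h']
        · rw [if_neg h', if_neg (by rw [skip]; split_ifs <;> omega),
            ← r.leafStart_splitLeaf_skip (i := i - l.numLeaves) (k := k - l.numLeaves)
              (by omega) (by omega)]
          rw [show skip (i - l.numLeaves + 1) (k - l.numLeaves) = skip (i + 1) k - l.numLeaves by
            rw [skip, skip]; split_ifs <;> omega]

theorem leafLength_splitLeaf_skip : ∀ (t : BinTree) {i k : ℕ}, i < t.numLeaves → k < t.numLeaves →
    (t.splitLeaf i).leafLength (skip (i + 1) k) =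
      if k = i then t.leafLength k / 2 else t.leafLength k
  | leaf, i, k, hi, hk => by
      obtain rfl : i = 0 := Nat.lt_one_iff.1 hi
      obtain rfl : k = 0 := Nat.lt_one_iff.1 hk
      simp [splitLeaf, leafLength, skip, numLeaves]
  | caret l r, i, k, hi, hk => by
      rw [numLeaves] at hi hk
      rw [splitLeaf]
      by_cases h : i < l.numLeaves
      · rw [if_pos h, leafLength, leafLength, numLeaves_splitLeaf]
        by_cases h' : k < l.numLeaves
        · rw [if_pos h', if_pos (by rw [skip]; split_ifs <;> omega),
            l.leafLength_splitLeaf_skip h h']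
          split_ifs <;> rfl
        · rw [if_neg h', if_neg (by rw [skip]; split_ifs <;> omega), if_neg (by omega)]
          rw [show skip (i + 1) k - (l.numLeaves + 1) = k - l.numLeaves by
            rw [skip]; split_ifs <;> omega]
      · rw [if_neg h, leafLength, leafLength]
        by_cases h' : k < l.numLeaves
        · rw [if_pos h', show skip (i + 1) k = k by rw [skip]; split_ifs <;> omega, if_pos h',
            if_neg (by omega)]
        · have := r.leafLength_splitLeaf_skip (i := i - l.numLeaves) (k := k - l.numLeaves)
              (by omega) (by omega)
          rw [show skip (i - l.numLeaves + 1) (k - l.numLeaves) = skip (i + 1) k - l.numLeaves by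
            rw [skip, skip]; split_ifs <;> omega] at this
          rw [if_neg h', if_neg (by rw [skip]; split_ifs <;> omega), this]
          by_cases hki : k = i
          · simp [hki]
          · rw [if_neg hki, if_neg (by omega)]

theorem leafStart_splitLeaf_succ : ∀ (t : BinTree) {i : ℕ}, i < t.numLeaves →
    (t.splitLeaf i).leafStart (i + 1) = t.leafStart i + t.leafLength i / 2
  | leaf, i, hi => by
      obtain rfl : i = 0 := Nat.lt_one_iff.1 hi
      simp [splitLeaf, leafStart, leafLength, numLeaves]
  | caret l r, i, hi => by
      rw [numLeaves] at hi
      rw [splitLeaf]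
      by_cases h : i < l.numLeaves
      · rw [if_pos h, leafStart, leafStart, leafLength, numLeaves_splitLeaf, if_pos h, if_pos h,
          if_pos (by omega), l.leafStart_splitLeaf_succ h]
        ring
      · rw [if_neg h, leafStart, leafStart, leafLength, if_neg h, if_neg h, if_neg (by omega),
          show i + 1 - l.numLeaves = i - l.numLeaves + 1 by omega,
          r.leafStart_splitLeaf_succ (by omega)]
        ring

theorem leafLength_splitLeaf_succ : ∀ (t : BinTree) {i : ℕ}, i < t.numLeaves →
    (t.splitLeaf i).leafLength (i + 1) = t.leafLength i / 2
  | leaf, i, hi => by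
      obtain rfl : i = 0 := Nat.lt_one_iff.1 hi
      simp [splitLeaf, leafLength, numLeaves]
  | caret l r, i, hi => by
      rw [numLeaves] at hi
      rw [splitLeaf]
      by_cases h : i < l.numLeaves
      · rw [if_pos h, leafLength, leafLength, numLeaves_splitLeaf, if_pos h,
          if_pos (by omega), l.leafLength_splitLeaf_succ h]
      · rw [if_neg h, leafLength, leafLength, if_neg h, if_neg (by omega),
          show i + 1 - l.numLeaves = i - l.numLeaves + 1 by omega,
          r.leafLength_splitLeaf_succ (by omega)]

/-- In the half-graph the new caret is a pendant edge from `i` to the new vertex `i + 1`; the other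
edges are merely renumbered. -/
theorem weight_splitLeaf {C R : Type*} [CommRing R] (w : C → C → R) :
    ∀ (t : BinTree) {i : ℕ} (f : ℕ → C), i < t.numLeaves →
      (t.splitLeaf i).weight w f =
        t.weight w (fun k => f (skip (i + 1) k)) * w (f i) (f (i + 1))
  | leaf, i, f, hi => by
      obtain rfl : i = 0 := Nat.lt_one_iff.1 hi
      simp [splitLeaf, weight, numLeaves]
  | caret l r, i, f, hi => by
      have hl := l.numLeaves_pos
      rw [numLeaves] at hi
      rw [splitLeaf]
      have h0 : skip (i + 1) 0 = 0 := rfl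
      by_cases h : i < l.numLeaves
      · have h1 : skip (i + 1) l.numLeaves = l.numLeaves + 1 := if_neg (by omega)
        have h2 : ∀ k, skip (i + 1) (l.numLeaves + k) = l.numLeaves + 1 + k := fun k => by
          rw [skip, if_neg (by omega)]; omega
        rw [if_pos h, weight, weight, numLeaves_splitLeaf, l.weight_splitLeaf w f h]
        simp only [h0, h1, h2]
        ring
      · have h1 : skip (i + 1) l.numLeaves = l.numLeaves := if_pos (by omega)
        have h2 : ∀ k, skip (i + 1) (l.numLeaves + k) =
            l.numLeaves + skip (i - l.numLeaves + 1) k := fun k => by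
          rw [skip, skip]; split_ifs <;> omega
        have h3 : ∀ k < l.numLeaves, f k = f (skip (i + 1) k) := fun k hk => by
          rw [skip, if_pos (by omega)]
        rw [if_neg h, weight, weight, r.weight_splitLeaf w _ (i := i - l.numLeaves) (by omega),
          l.weight_congr w h3]
        simp only [h0, h1, h2]
        rw [show l.numLeaves + (i - l.numLeaves) = i by omega,
          show l.numLeaves + (i - l.numLeaves + 1) = i + 1 by omega]
        ring

/-! ### Common refinements of trees -/

/-- `Refines t u`: the tree `u` arises from `t` by attaching carets. -/
def Refines : BinTree → BinTree → Prop :=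
  Relation.ReflTransGen fun t u => ∃ i < t.numLeaves, u = t.splitLeaf i

theorem Refines.caret_left {l l' : BinTree} (h : Refines l l') (r : BinTree) :
    Refines (caret l r) (caret l' r) := by
  refine Relation.ReflTransGen.lift (fun l => caret l r) ?_ _ _ h
  rintro a _ ⟨i, hi, rfl⟩
  exact ⟨i, by rw [numLeaves]; omega, by rw [splitLeaf, if_pos hi]⟩

theorem Refines.caret_right {r r' : BinTree} (l : BinTree) (h : Refines r r') :
    Refines (caret l r) (caret l r') := by
  refine Relation.ReflTransGen.lift (fun r => caret l r) ?_ _ _ h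
  rintro a _ ⟨i, hi, rfl⟩
  refine ⟨l.numLeaves + i, by rw [numLeaves]; omega, ?_⟩
  rw [splitLeaf, if_neg (by omega), Nat.add_sub_cancel_left]

theorem refines_leaf : ∀ t : BinTree, Refines leaf t
  | leaf => Relation.ReflTransGen.refl
  | caret l r => by
      have h : Refines leaf (caret leaf leaf) :=
        Relation.ReflTransGen.single ⟨0, Nat.one_pos, rfl⟩
      exact (h.trans ((refines_leaf l).caret_left leaf)).trans ((refines_leaf r).caret_right l)

/-- Superpose the trees from the root: a leaf is refined by any tree, and two carets are treated
branch by branch. -/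
theorem exists_common_refinement : ∀ t u : BinTree, ∃ v, Refines t v ∧ Refines u v
  | leaf, u => ⟨u, refines_leaf u, Relation.ReflTransGen.refl⟩
  | caret l r, leaf => ⟨caret l r, Relation.ReflTransGen.refl, refines_leaf _⟩
  | caret l r, caret l' r' => by
      obtain ⟨a, ha, ha'⟩ := exists_common_refinement l l'
      obtain ⟨b, hb, hb'⟩ := exists_common_refinement r r'
      exact ⟨caret a b, (ha.caret_left r).trans (hb.caret_right a),
        (ha'.caret_left r').trans (hb'.caret_right a)⟩

theorem exists_common_refinement_family {ι : Type*} [Fintype ι] (t : ι → BinTree) :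
    ∃ v, ∀ i, Refines (t i) v := by
  classical
  have h : ∀ s : Finset ι, ∃ v, ∀ i ∈ s, Refines (t i) v := by
    intro s
    induction s using Finset.induction_on with
    | empty => exact ⟨leaf, by simp⟩
    | insert a s _ ih =>
      obtain ⟨v, hv⟩ := ih
      obtain ⟨u, hu, hu'⟩ := exists_common_refinement (t a) v
      refine ⟨u, fun i hi => ?_⟩
      rcases Finset.mem_insert.1 hi with rfl | hi
      · exact hu
      · exact (hv i hi).trans hu'
  obtain ⟨v, hv⟩ := h Finset.univ
  exact ⟨v, fun i => hv i (Finset.mem_univ i)⟩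

theorem leafStart_zero : ∀ t : BinTree, t.leafStart 0 = 0
  | leaf => rfl
  | caret l r => by rw [leafStart, if_pos l.numLeaves_pos, l.leafStart_zero, zero_div]

theorem leafStart_mem : ∀ (t : BinTree) (k : ℕ), t.leafStart k ∈ Set.Ico (0 : ℝ) 1
  | leaf, _ => by simp [leafStart]
  | caret l r, k => by
      have hl := l.leafStart_mem k
      have hr := r.leafStart_mem (k - l.numLeaves)
      rw [Set.mem_Ico] at *
      rw [leafStart]
      split_ifs <;> constructor <;> linarith [hl.1, hl.2, hr.1, hr.2]

theorem leafStart_lt : ∀ (t : BinTree) {i k : ℕ}, i < k → k < t.numLeaves →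
    t.leafStart i < t.leafStart k
  | leaf, i, k, hik, hk => by rw [numLeaves] at hk; omega
  | caret l r, i, k, hik, hk => by
      rw [numLeaves] at hk
      rw [leafStart, leafStart]
      split_ifs with h1 h2 h2
      · linarith [l.leafStart_lt hik h2]
      · linarith [(l.leafStart_mem i).2, (r.leafStart_mem (k - l.numLeaves)).1]
      · omega
      · linarith [r.leafStart_lt (i := i - l.numLeaves) (k := k - l.numLeaves) (by omega)
          (by omega)]

theorem leafStart_inj (t : BinTree) {i k : ℕ} (hi : i < t.numLeaves) (hk : k < t.numLeaves)
    (h : t.leafStart i = t.leafStart k) : i = k := by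
  rcases lt_trichotomy i k with h' | h' | h'
  · exact absurd h (t.leafStart_lt h' hk).ne
  · exact h'
  · exact absurd h (t.leafStart_lt h' hi).ne'

/-- A tree is determined by its subdivision of the unit interval. -/
theorem eq_of_leafStart_eq : ∀ t u : BinTree, t.numLeaves = u.numLeaves →
    (∀ k < t.numLeaves, t.leafStart k = u.leafStart k) → t = u
  | leaf, leaf, _, _ => rfl
  | leaf, caret l r, h, _ => by
      have := l.numLeaves_pos; have := r.numLeaves_pos
      simp only [numLeaves] at h; omega
  | caret l r, leaf, h, _ => by
      have := l.numLeaves_pos; have := r.numLeaves_pos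
      simp only [numLeaves] at h; omega
  | caret l r, caret l' r', hn, h => by
      have hr := r.numLeaves_pos
      have hr' := r'.numLeaves_pos
      simp only [numLeaves] at hn h
      -- The left subtree has as many leaves as there are endpoints below `1/2`.
      have hl : l.numLeaves = l'.numLeaves := by
        rcases lt_trichotomy l.numLeaves l'.numLeaves with h' | h' | h'
        · have := h l.numLeaves (by omega)
          rw [leafStart, leafStart, if_neg (lt_irrefl _), if_pos h'] at this
          linarith [(l'.leafStart_mem l.numLeaves).2, (r.leafStart_mem (l.numLeaves - l.numLeaves)).1]
        · exact h'
        · have := h l'.numLeaves (by omega)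
          rw [leafStart, leafStart, if_neg (lt_irrefl _), if_pos h'] at this
          linarith [(l.leafStart_mem l'.numLeaves).2,
            (r'.leafStart_mem (l'.numLeaves - l'.numLeaves)).1]
      rw [eq_of_leafStart_eq l l' hl fun k hk => ?_,
        eq_of_leafStart_eq r r' (by omega) fun k hk => ?_]
      · have := h (l.numLeaves + k) (by omega)
        rw [leafStart, leafStart, if_neg (by omega), if_neg (by omega), ← hl,
          Nat.add_sub_cancel_left] at this
        linarith
      · have := h k (by omega)
        rw [leafStart, leafStart, if_pos hk, if_pos (hl ▸ hk)] at this
        linarith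

end BinTree

/-! ### Splitting joined leaves of a tree diagram -/

theorem Nat.add_mod_eq_ite_of_lt {a b n : ℕ} (ha : a < n) (hb : b < n) :
    (a + b) % n = if a + b < n then a + b else a + b - n := by
  split_ifs with h
  · exact Nat.mod_eq_of_lt h
  · rw [Nat.mod_eq_sub_mod (not_lt.1 h), Nat.mod_eq_of_lt (by omega)]

theorem skip_injective (p : ℕ) : Function.Injective (skip p) := by
  intro a b h
  rw [skip, skip] at h
  split_ifs at h <;> omega

theorem skip_lt {p k n : ℕ} (hk : k < n) : skip p k < n + 1 := by
  rw [skip]; split_ifs <;> omega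

theorem skip_ne (p k : ℕ) : skip p k ≠ p := by
  rw [skip]; split_ifs <;> omega

theorem exists_skip_eq {p k n : ℕ} (hp : p ≤ n) (hk : k < n + 1) (h : k ≠ p) :
    ∃ j < n, skip p j = k := by
  rcases lt_or_gt_of_ne h with h | h
  · exact ⟨k, by omega, if_pos h⟩
  · exact ⟨k - 1, by omega, by rw [skip, if_neg (by omega)]; omega⟩

namespace TreeDiagram

/-- The leaf of the top tree joined to the leaf `p` of the bottom tree. -/
def topLeaf (D : TreeDiagram) (p : ℕ) : ℕ := if D.mark ≤ p then p - D.mark else p + D.n - D.mark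

variable {D : TreeDiagram} {p : ℕ}

theorem topLeaf_lt (hp : p < D.n) : D.topLeaf p < D.n := by
  have := D.mark_lt
  rw [topLeaf]; split_ifs <;> omega

theorem mark_add_topLeaf (hp : p < D.n) : (D.mark + D.topLeaf p) % D.n = p := by
  have hm : D.mark < D.n := D.mark_lt
  rw [Nat.add_mod_eq_ite_of_lt hm (topLeaf_lt hp), topLeaf]
  split_ifs <;> omega

variable (D) in
/-- Attach carets to a leaf of the bottom tree and to the leaf of the top tree joined to it. -/
def split (p : ℕ) (_hp : p < D.n) : TreeDiagram where
  top := D.top.splitLeaf (D.topLeaf p)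
  bottom := D.bottom.splitLeaf p
  numLeaves_eq := by rw [BinTree.numLeaves_splitLeaf, BinTree.numLeaves_splitLeaf, D.numLeaves_eq]
  mark := skip (p + 1) D.mark
  mark_lt := by rw [BinTree.numLeaves_splitLeaf]; exact skip_lt D.mark_lt

theorem n_split (hp : p < D.n) : (D.split p hp).n = D.n + 1 := BinTree.numLeaves_splitLeaf _ _

/-- After renumbering, old leaves remain joined as before; `split_mark_add_succ` says that the two
new leaves are joined to each other. -/
theorem split_mark_add_skip (hp : p < D.n) {k : ℕ} (hk : k < D.n) :
    (skip (p + 1) D.mark + skip (D.topLeaf p + 1) k) % (D.n + 1) =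
      skip (p + 1) ((D.mark + k) % D.n) := by
  have hm : D.mark < D.n := D.mark_lt
  rw [Nat.add_mod_eq_ite_of_lt (skip_lt hm) (skip_lt hk), Nat.add_mod_eq_ite_of_lt hm hk]
  simp only [skip, topLeaf]
  split_ifs <;> omega

theorem split_mark_add_succ (hp : p < D.n) :
    (skip (p + 1) D.mark + (D.topLeaf p + 1)) % (D.n + 1) = p + 1 := by
  have hm : D.mark < D.n := D.mark_lt
  rw [Nat.add_mod_eq_ite_of_lt (skip_lt hm) (Nat.succ_lt_succ (topLeaf_lt hp))]
  simp only [skip, topLeaf]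
  split_ifs <;> omega

theorem Represents.split {g : thompsonT} (h : D.Represents g) (hp : p < D.n) :
    (D.split p hp).Represents g := by
  have hnt : D.top.numLeaves = D.n := D.numLeaves_eq
  have ht : D.topLeaf p < D.top.numLeaves := hnt ▸ topLeaf_lt hp
  intro j hj x hx0 hx1
  rw [n_split] at hj ⊢
  change (g : Circle1 ≃ₜ Circle1)
    (((D.bottom.splitLeaf p).leafStart ((skip (p + 1) D.mark + j) % (D.n + 1)) +
      x * (D.bottom.splitLeaf p).leafLength ((skip (p + 1) D.mark + j) % (D.n + 1)) : ℝ) :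
        Circle1) = (((D.top.splitLeaf (D.topLeaf p)).leafStart j +
          x * (D.top.splitLeaf (D.topLeaf p)).leafLength j : ℝ) : Circle1)
  by_cases hjt : j = D.topLeaf p + 1
  · subst hjt
    rw [split_mark_add_succ hp, BinTree.leafStart_splitLeaf_succ _ hp,
      BinTree.leafLength_splitLeaf_succ _ hp, BinTree.leafStart_splitLeaf_succ _ ht,
      BinTree.leafLength_splitLeaf_succ _ ht]
    -- The affine map on the old interval restricts to its right half; the left half is the case `x
    -- / 2` below.
    have := h (D.topLeaf p) (topLeaf_lt hp) ((1 + x) / 2) (by linarith) (by linarith)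
    rw [mark_add_topLeaf hp] at this
    exact (congrArg (fun y : ℝ => (g : Circle1 ≃ₜ Circle1) (y : Circle1)) (by ring)).trans
      (this.trans (congrArg (fun y : ℝ => (y : Circle1)) (by ring)))
  · obtain ⟨k, hk, rfl⟩ := exists_skip_eq (topLeaf_lt hp) hj hjt
    have hmod : (D.mark + k) % D.n < D.bottom.numLeaves := Nat.mod_lt _ D.bottom.numLeaves_pos
    have hk' : k < D.top.numLeaves := hnt ▸ hk
    rw [split_mark_add_skip hp hk, BinTree.leafStart_splitLeaf_skip _ hp hmod,
      BinTree.leafLength_splitLeaf_skip _ hp hmod, BinTree.leafStart_splitLeaf_skip _ ht hk',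
      BinTree.leafLength_splitLeaf_skip _ ht hk']
    by_cases hkp : k = D.topLeaf p
    · subst hkp
      rw [mark_add_topLeaf hp, if_pos rfl, if_pos rfl]
      have := h (D.topLeaf p) (topLeaf_lt hp) (x / 2) (by linarith) (by linarith)
      rw [mark_add_topLeaf hp] at this
      exact (congrArg (fun y : ℝ => (g : Circle1 ≃ₜ Circle1) (y : Circle1)) (by ring)).trans
        (this.trans (congrArg (fun y : ℝ => (y : Circle1)) (by ring)))
    · have hne : (D.mark + k) % D.n ≠ p := by
        have hm : D.mark < D.n := D.mark_lt
        rw [Nat.add_mod_eq_ite_of_lt hm hk]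
        rw [topLeaf] at hkp
        split_ifs at hkp ⊢ <;> omega
      rw [if_neg hne, if_neg hkp]
      exact h k hk x hx0 hx1

/-- The vertices after a split: the new vertex and the old ones. -/
theorem exists_split_equiv (hp : p < D.n) : ∃ e : Option (ZMod D.n) ≃ ZMod (D.split p hp).n,
    e none = ((p + 1 : ℕ) : ZMod (D.split p hp).n) ∧
      ∀ k < D.n, e (some (k : ZMod D.n)) = (skip (p + 1) k : ZMod (D.split p hp).n) := by
  let f : Option (ZMod D.n) → ZMod (D.split p hp).n := fun o =>
    o.elim ((p + 1 : ℕ) : ZMod (D.split p hp).n) fun v => (skip (p + 1) v.val : ℕ)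
  have hn := n_split hp
  have hval : ∀ v : ZMod D.n, skip (p + 1) v.val < (D.split p hp).n := fun v =>
    hn ▸ skip_lt (ZMod.val_lt v)
  have hp' : p + 1 < (D.split p hp).n := by omega
  have hf : Function.Injective f := by
    rintro (_ | u) (_ | v) h
    · rfl
    · exact absurd (((D.split p hp).natCast_inj hp' (hval v)).1 h).symm (skip_ne _ _)
    · exact absurd (((D.split p hp).natCast_inj (hval u) hp').1 h) (skip_ne _ _)
    · exact congrArg some (ZMod.val_injective _
        (skip_injective _ (((D.split p hp).natCast_inj (hval u) (hval v)).1 h)))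
  have hb : Function.Bijective f := by
    refine (Fintype.bijective_iff_injective_and_card f).2 ⟨hf, ?_⟩
    rw [Fintype.card_option, ZMod.card, ZMod.card, hn]
  refine ⟨Equiv.ofBijective f hb, rfl, fun k hk => ?_⟩
  change ((skip (p + 1) (k : ZMod D.n).val : ℕ) : ZMod (D.split p hp).n) = _
  rw [ZMod.val_natCast_of_lt hk]

/-- The new vertex is joined only to the vertex `p`, by one upper and one lower edge, so summing
over its colour gives `K`. -/
theorem partitionFunction_split {C R : Type*} [Fintype C] [CommRing R] {w w' : C → C → R} {K : R}
    (hK : ∀ a, ∑ c, w a c * w' a c = K) (hp : p < D.n) :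
    (D.split p hp).partitionFunction w w' = K * D.partitionFunction w w' := by
  obtain ⟨e, he0, he⟩ := exists_split_equiv hp
  have hnt : D.top.numLeaves = D.n := D.numLeaves_eq
  have ht : D.topLeaf p < D.top.numLeaves := hnt ▸ topLeaf_lt hp
  have hmod : ∀ a : ℕ, ((a % (D.n + 1) : ℕ) : ZMod (D.split p hp).n) = a := fun a => by
    rw [← n_split hp, ZMod.natCast_mod]
  have hmod' : ∀ a : ℕ, ((a % D.n : ℕ) : ZMod D.n) = a := fun a => ZMod.natCast_mod a _
  have hskip : ∀ k < D.n, ((skip (D.topLeaf p + 1) k : ℕ) : ZMod (D.split p hp).n) +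
      (skip (p + 1) D.mark : ℕ) = e (some ((k : ZMod D.n) + D.mark)) := by
    intro k hk
    rw [← Nat.cast_add, ← hmod, add_comm, split_mark_add_skip hp hk,
      ← he _ (Nat.mod_lt _ D.bottom.numLeaves_pos), hmod', Nat.cast_add, add_comm]
  have hsucc : ((D.topLeaf p + 1 : ℕ) : ZMod (D.split p hp).n) +
      (skip (p + 1) D.mark : ℕ) = e none := by
    rw [← Nat.cast_add, ← hmod, add_comm, split_mark_add_succ hp, he0]
  have htop : ((D.topLeaf p : ℕ) : ZMod (D.split p hp).n) +
      (skip (p + 1) D.mark : ℕ) = e (some (p : ZMod D.n)) := by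
    have h1 : skip (D.topLeaf p + 1) (D.topLeaf p) = D.topLeaf p := if_pos (Nat.lt_succ_self _)
    have h2 := hskip _ (topLeaf_lt hp)
    rw [h1] at h2
    rw [h2, ← Nat.cast_add, ← hmod', add_comm, mark_add_topLeaf hp]
  have hbot : (p : ZMod (D.split p hp).n) = e (some (p : ZMod D.n)) := by
    rw [he p hp, skip, if_pos (Nat.lt_succ_self _)]
  -- A colouring after the split is a colour of the new vertex together with a colouring of the old
  -- ones.
  let E : C × (ZMod D.n → C) ≃ (ZMod (D.split p hp).n → C) :=
    (Equiv.piOptionEquivProd (β := fun _ : Option (ZMod D.n) => C)).symm.trans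
      (e.arrowCongr (Equiv.refl C))
  have hE0 : ∀ c ρ, E (c, ρ) (e none) = c := fun c ρ => by
    simp [E, Equiv.piOptionEquivProd]
  have hE1 : ∀ c ρ v, E (c, ρ) (e (some v)) = ρ v := fun c ρ v => by
    simp [E, Equiv.piOptionEquivProd]
  rw [partitionFunction, ← E.sum_comp, Fintype.sum_prod_type, Finset.sum_comm, partitionFunction,
    Finset.mul_sum]
  refine Finset.sum_congr rfl fun ρ _ => ?_
  rw [← hK (ρ p), Finset.sum_mul]
  refine Finset.sum_congr rfl fun c _ => ?_
  have h1 : (D.split p hp).top.weight w (fun k => E (c, ρ) ((k : ZMod (D.split p hp).n) +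
      (D.split p hp).mark)) = D.top.weight w (fun k => ρ ((k : ZMod D.n) + D.mark)) *
        w (ρ p) c := by
    change (D.top.splitLeaf (D.topLeaf p)).weight w (fun k => E (c, ρ)
      ((k : ZMod (D.split p hp).n) + (skip (p + 1) D.mark : ℕ))) = _
    rw [BinTree.weight_splitLeaf _ _ _ ht, hsucc, htop, hE0, hE1]
    congr 1
    refine BinTree.weight_congr _ _ fun k hk => ?_
    rw [hskip k (hnt ▸ hk), hE1]
  have h2 : (D.split p hp).bottom.weight w' (fun k => E (c, ρ) (k : ZMod (D.split p hp).n)) =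
      D.bottom.weight w' (fun k => ρ k) * w' (ρ p) c := by
    change (D.bottom.splitLeaf p).weight w' (fun k => E (c, ρ) (k : ZMod (D.split p hp).n)) = _
    rw [BinTree.weight_splitLeaf _ _ _ hp, ← he0, hbot, hE0, hE1]
    congr 1
    refine BinTree.weight_congr _ _ fun k hk => ?_
    rw [← he k hk, hE1]
  rw [h1, h2]
  ring

/-! ### Independence of the tree diagram -/

/-- `Expands D D'`: the diagram `D'` arises from `D` by splitting leaves. -/
def Expands : TreeDiagram → TreeDiagram → Prop :=
  Relation.ReflTransGen fun D D' => ∃ p, ∃ hp : p < D.n, D' = D.split p hp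

variable {D' : TreeDiagram}

theorem Expands.represents (h : Expands D D') {g : thompsonT} (hg : D.Represents g) :
    D'.Represents g := by
  induction h with
  | refl => exact hg
  | tail _ h ih =>
    obtain ⟨p, hp, rfl⟩ := h
    exact ih.split hp

/-- Stated without division, so that it serves both over `ℤ` with `K = 1` and over `ℂ` with `K = q`.
-/
theorem Expands.partitionFunction {C R : Type*} [Fintype C] [CommRing R] {w w' : C → C → R} {K : R}
    (h : Expands D D') (hK : ∀ a, ∑ c, w a c * w' a c = K) :
    K ^ D.n * D'.partitionFunction w w' = K ^ D'.n * D.partitionFunction w w' := by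
  induction h with
  | refl => rfl
  | tail _ h ih =>
    obtain ⟨p, hp, rfl⟩ := h
    rw [partitionFunction_split hK hp, mul_left_comm, ih, n_split, pow_succ']
    ring

/-- Refinements can be prescribed on the bottom tree; the top tree follows by splitting the joined
leaves. -/
theorem exists_expands (D : TreeDiagram) {u : BinTree} (h : D.bottom.Refines u) :
    ∃ D', Expands D D' ∧ D'.bottom = u := by
  induction h with
  | refl => exact ⟨D, Relation.ReflTransGen.refl, rfl⟩
  | tail _ h ih =>
    obtain ⟨i, hi, rfl⟩ := h
    obtain ⟨D', h1, rfl⟩ := ih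
    exact ⟨D'.split i hi, h1.tail ⟨i, hi, rfl⟩, rfl⟩

theorem circle_coe_injOn {x y : ℝ} (hx : x ∈ Set.Ico (0 : ℝ) 1) (hy : y ∈ Set.Ico (0 : ℝ) 1)
    (h : (x : Circle1) = y) : x = y := by
  have : Fact ((0 : ℝ) < 1) := ⟨one_pos⟩
  rw [← zero_add (1 : ℝ)] at hx hy
  exact (AddCircle.coe_eq_coe_iff_of_mem_Ico hx hy).1 h

/-- A diagram of a given element is determined by its bottom tree. -/
theorem Represents.unique {g : thompsonT} (h : D.Represents g) (h' : D'.Represents g)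
    (hb : D.bottom = D'.bottom) : D = D' := by
  have hstart : ∀ {E : TreeDiagram}, E.Represents g → ∀ j < E.n, (g : Circle1 ≃ₜ Circle1)
      ((E.bottom.leafStart ((E.mark + j) % E.n) : ℝ) : Circle1) =
        ((E.top.leafStart j : ℝ) : Circle1) := fun hE j hj => by
    simpa using hE j hj 0 le_rfl one_pos
  obtain ⟨S, T, hn, c, hc⟩ := D
  obtain ⟨S', T', hn', c', hc'⟩ := D'
  obtain rfl : T = T' := hb
  have hs := hstart h
  have hs' := hstart h'
  simp only at hs hs'
  -- The marked leaf starts at the preimage of 0. The endpoints of the top tree are likewise forced,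
  -- as images of the endpoints of the bottom tree.
  have hcc : c = c' := by
    have h1 := hs 0 T.numLeaves_pos
    have h2 := hs' 0 T.numLeaves_pos
    rw [add_zero, Nat.mod_eq_of_lt hc, BinTree.leafStart_zero] at h1
    rw [add_zero, Nat.mod_eq_of_lt hc', BinTree.leafStart_zero] at h2
    exact T.leafStart_inj hc hc' (circle_coe_injOn (T.leafStart_mem _) (T.leafStart_mem _)
      ((g : Circle1 ≃ₜ Circle1).injective (h1.trans h2.symm)))
  subst hcc
  obtain rfl : S = S' := BinTree.eq_of_leafStart_eq _ _ (hn.trans hn'.symm) fun k hk =>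
    circle_coe_injOn (S.leafStart_mem _) (S'.leafStart_mem _)
      ((hs k (hk.trans_eq hn)).symm.trans (hs' k (hk.trans_eq hn)))
  rfl

/-- The normalised partition function depends only on the element of Thompson's group. -/
theorem Represents.partitionFunction_eq {C R : Type*} [Fintype C] [CommRing R] [IsDomain R]
    {w w' : C → C → R} {K : R} (hK : ∀ a, ∑ c, w a c * w' a c = K) (hK0 : K ≠ 0) {g : thompsonT}
    (h : D.Represents g) (h' : D'.Represents g) :
    K ^ D'.n * D.partitionFunction w w' = K ^ D.n * D'.partitionFunction w w' := by
  obtain ⟨u, hu, hu'⟩ := BinTree.exists_common_refinement D.bottom D'.bottom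
  obtain ⟨E, hE, rfl⟩ := exists_expands D hu
  obtain ⟨E', hE', hEE⟩ := exists_expands D' hu'
  obtain rfl := (hE'.represents h').unique (hE.represents h) hEE
  have h1 := hE.partitionFunction hK
  have h2 := hE'.partitionFunction hK
  refine mul_left_cancel₀ (pow_ne_zero E'.n hK0) ?_
  rw [mul_left_comm, ← h1, mul_left_comm (K ^ E'.n), ← h2]
  ring

end TreeDiagram

/-! ### Quotients of elements with a common bottom tree -/

namespace TreeDiagram

variable {D D' : TreeDiagram}

/-- The diagram of `g * h⁻¹`, for diagrams of `g` and `h` with the same bottom tree. -/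
def quotient (D D' : TreeDiagram) (h : D.bottom = D'.bottom) : TreeDiagram where
  top := D.top
  bottom := D'.top
  numLeaves_eq := by rw [D.numLeaves_eq, D'.numLeaves_eq, h]
  -- The difference of the marks modulo `n`, arranged to avoid truncated subtraction.
  mark := (D.mark + (D'.n - D'.mark)) % D'.n
  mark_lt := by rw [D'.numLeaves_eq]; exact Nat.mod_lt _ D'.bottom.numLeaves_pos

/-- The intervals of `D'.top` are carried back by `g'⁻¹` to those of the common bottom tree, and
from there by `g` to those of `D.top`. -/
theorem Represents.quotient {g g' : thompsonT} (hg : D.Represents g) (hg' : D'.Represents g')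
    (h : D.bottom = D'.bottom) : (D.quotient D' h).Represents (g * g'⁻¹) := by
  have hn : (D.quotient D' h).n = D'.n := D'.numLeaves_eq
  have hnn : D.n = D'.n := congrArg BinTree.numLeaves h
  intro l hl x hx0 hx1
  rw [hn] at hl ⊢
  set j := ((D.quotient D' h).mark + l) % D'.n with hj
  have hjn : j < D'.n := Nat.mod_lt _ D'.bottom.numLeaves_pos
  have hm : (D'.mark + j) % D'.n = (D.mark + l) % D.n := by
    have hlt : D'.mark < D'.n := D'.mark_lt
    rw [hj, hnn]
    change (D'.mark + ((D.mark + (D'.n - D'.mark)) % D'.n + l) % D'.n) % D'.n = _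
    rw [Nat.add_mod_mod, ← Nat.add_assoc, Nat.add_right_comm, Nat.add_mod_mod,
      show D'.mark + l + (D.mark + (D'.n - D'.mark)) = D.mark + l + D'.n by omega,
      Nat.add_mod_right]
  have h1 := hg' j hjn x hx0 hx1
  have h2 := hg l (hnn ▸ hl) x hx0 hx1
  rw [hm] at h1
  rw [h] at h2
  change (g : Circle1 ≃ₜ Circle1) ((g' : Circle1 ≃ₜ Circle1).symm
    ((D'.top.leafStart j + x * D'.top.leafLength j : ℝ) : Circle1)) = _
  rw [← h1, Homeomorph.symm_apply_apply, h2]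
  rfl

/-- The weight of the top half-graph. -/
def topWeight {C R : Type*} [CommRing R] (D : TreeDiagram) (n : ℕ) (w : C → C → R)
    (σ : ZMod n → C) : R := D.top.weight w fun k => σ ((k : ZMod n) + D.mark)

/-- The partition function of a quotient as a sum over the states of the common bottom tree. -/
theorem partitionFunction_quotient {C R : Type*} [Fintype C] [CommRing R] (w w' : C → C → R)
    (h : D.bottom = D'.bottom) (n : ℕ) [NeZero n] (hn : D'.n = n) :
    (D.quotient D' h).partitionFunction w w' =
      ∑ σ : ZMod n → C, D.topWeight n w σ * D'.topWeight n w' σ := by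
  have hn' : (D.quotient D' h).n = n := D'.numLeaves_eq.trans hn
  subst hn'
  have hmark : ((D.quotient D' h).mark : ZMod (D.quotient D' h).n) = D.mark - D'.mark := by
    have hlt : D'.mark < D'.n := D'.mark_lt
    change (((D.mark + (D'.n - D'.mark)) % D'.n : ℕ) : ZMod (D.quotient D' h).n) = _
    rw [hn, ZMod.natCast_mod, Nat.cast_add, Nat.cast_sub (hn ▸ hlt.le), ZMod.natCast_self, zero_sub,
      sub_eq_add_neg]
  symm
  -- The quotient numbers its vertices from the first leaf of `D'.top`, the right-hand side from the
  -- first leaf of the common bottom tree; rotating colourings by `D'.mark` matches them.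
  refine Fintype.sum_equiv ((Equiv.subRight (D'.mark : ZMod (D.quotient D' h).n)).arrowCongr
    (Equiv.refl C)) _ _ fun σ => ?_
  refine congrArg₂ _ ?_ ?_
  · refine congrArg (D.top.weight w) (funext fun k => ?_)
    simp only [Equiv.arrowCongr_apply, Function.comp, Equiv.refl_apply, Equiv.subRight_symm_apply,
      hmark]
    congr 1
    ring
  · rfl

theorem topWeight_conj {C : Type*} [DecidableEq C] (D : TreeDiagram) (n : ℕ) (x : ℂ)
    (σ : ZMod n → C) : star (D.topWeight n (pottsWeight x) σ) =
      D.topWeight n (pottsWeight (star x)) σ := by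
  rw [topWeight, topWeight, BinTree.weight_eq_prod, BinTree.weight_eq_prod, star_prod]
  refine Finset.prod_congr rfl fun i _ => ?_
  rw [pottsWeight, pottsWeight]
  split_ifs <;> simp

/-! ### Two-colourings -/

/-- With weight 0 on monochromatic edges only proper colourings survive, so the invariance of
partition functions applies to chromatic values. -/
theorem chromaticValue_graph (D : TreeDiagram) : (chromaticValue D.graph 2 : ℤ) =
    D.partitionFunction (pottsWeight (C := Fin 2) 0) (pottsWeight 0) := by
  classical
  have hadj : ∀ σ : ZMod D.n → Fin 2,
      (∀ {u v}, D.graph.Adj u v → (⊤ : SimpleGraph (Fin 2)).Adj (σ u) (σ v)) ↔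
      ∀ e : D.Edge, σ (D.vertex (e, true)) ≠ σ (D.vertex (e, false)) := by
    intro σ
    constructor
    · intro h e
      exact h ⟨(e, true), rfl, rfl⟩
    · rintro h u v ⟨⟨e, b⟩, rfl, rfl⟩
      cases b
      · exact (h e).symm
      · exact h e
  let E : D.graph.Coloring (Fin 2) ≃ {σ : ZMod D.n → Fin 2 //
      ∀ e : D.Edge, σ (D.vertex (e, true)) ≠ σ (D.vertex (e, false))} :=
    { toFun := fun c => ⟨c, (hadj c).1 fun h => c.map_rel h⟩
      invFun := fun σ => ⟨σ.1, (hadj σ.1).2 σ.2⟩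
      left_inv := fun _ => rfl
      right_inv := fun _ => rfl }
  rw [chromaticValue, Nat.card_congr E, Nat.card_eq_fintype_card, Fintype.card_subtype,
    Finset.card_filter, partitionFunction_potts, Nat.cast_sum]
  refine Finset.sum_congr rfl fun σ _ => ?_
  by_cases h : ∀ e : D.Edge, σ (D.vertex (e, true)) ≠ σ (D.vertex (e, false))
  · rw [if_pos h, Finset.prod_eq_one fun e _ => if_neg (h e), Nat.cast_one]
  · rw [if_neg h, Nat.cast_zero]
    push Not at h
    obtain ⟨e, he⟩ := h
    rw [Finset.prod_eq_zero (Finset.mem_univ e)]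
    rw [if_pos he, ite_self]

theorem sum_pottsWeight_zero (a : Fin 2) :
    ∑ c : Fin 2, pottsWeight (0 : ℤ) a c * pottsWeight 0 a c = 1 := by
  fin_cases a <;> rfl

theorem Represents.chromaticValue_eq {g : thompsonT} (h : D.Represents g) (h' : D'.Represents g) :
    chromaticValue D.graph 2 = chromaticValue D'.graph 2 := by
  have := h.partitionFunction_eq sum_pottsWeight_zero one_ne_zero h'
  rw [one_pow, one_pow, one_mul, one_mul, ← chromaticValue_graph, ← chromaticValue_graph] at this
  exact_mod_cast this

/-- The diagram with one leaf. -/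
def trivialDiagram : TreeDiagram := ⟨.leaf, .leaf, rfl, 0, Nat.one_pos⟩

theorem represents_trivialDiagram : trivialDiagram.Represents 1 := by
  intro j hj x _ _
  simp [trivialDiagram, BinTree.leafStart, BinTree.leafLength]

theorem chromaticValue_trivialDiagram : chromaticValue trivialDiagram.graph 2 = 2 := by
  have h : (chromaticValue trivialDiagram.graph 2 : ℤ) = 2 := by
    rw [chromaticValue_graph]
    have : ∀ σ : ZMod trivialDiagram.n → Fin 2,
        trivialDiagram.top.weight (pottsWeight (0 : ℤ))
          (fun k => σ ((k : ZMod trivialDiagram.n) + trivialDiagram.mark)) *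
        trivialDiagram.bottom.weight (pottsWeight (0 : ℤ)) (fun k => σ k) = 1 := fun σ => rfl
    rw [partitionFunction, Finset.sum_congr rfl fun σ _ => this σ]
    rfl
  exact_mod_cast h

/-- Two-colourings of half-graphs: the square of the indicator function has sum `2`. -/
theorem sum_topWeight_sq (D : TreeDiagram) :
    ∑ σ : ZMod D.n → Fin 2, D.topWeight D.n (pottsWeight (0 : ℤ)) σ *
      D.topWeight D.n (pottsWeight 0) σ = 2 := by
  -- The sum is the chromatic value of `D.quotient D`, a diagram of the identity, and hence that of
  -- the one-leaf diagram.
  let E : TreeDiagram := ⟨D.top, D.top, rfl, 0, D.top.numLeaves_pos⟩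
  have hE : E.Represents 1 := by
    intro j hj x _ _
    change ((D.top.leafStart ((0 + j) % D.top.numLeaves) + x *
      D.top.leafLength ((0 + j) % D.top.numLeaves) : ℝ) : Circle1) = _
    rw [zero_add, Nat.mod_eq_of_lt hj]
  have h1 := hE.chromaticValue_eq represents_trivialDiagram
  rw [chromaticValue_trivialDiagram] at h1
  have h2 := chromaticValue_graph (D.quotient D rfl)
  rw [partitionFunction_quotient _ _ rfl D.n rfl] at h2
  rw [← h2]
  have h3 : D.quotient D rfl = E := by
    have hlt : D.mark < D.n := D.mark_lt
    simp only [quotient, E]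
    congr 1
    rw [Nat.add_sub_cancel' hlt.le, Nat.mod_self]
  rw [h3, h1]
  rfl

/-- For an oriented element the two half-graphs have the same proper two-colourings. -/
theorem topWeight_eq_weight_bottom (h : chromaticValue D.graph 2 = 2) (σ : ZMod D.n → Fin 2) :
    D.topWeight D.n (pottsWeight (0 : ℤ)) σ = D.bottom.weight (pottsWeight 0) (fun k => σ k) := by
  let E : TreeDiagram := ⟨D.bottom, D.bottom, rfl, 0, D.bottom.numLeaves_pos⟩
  have hb : ∀ σ : ZMod D.n → Fin 2, D.bottom.weight (pottsWeight (0 : ℤ)) (fun k => σ k) =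
      E.topWeight D.n (pottsWeight 0) σ := fun σ => by
    rw [topWeight]
    change _ = D.bottom.weight _ fun k => σ ((k : ZMod D.n) + (0 : ℕ))
    simp only [Nat.cast_zero, add_zero]
  have h1 := D.sum_topWeight_sq
  have h2 : ∑ σ : ZMod D.n → Fin 2, E.topWeight D.n (pottsWeight (0 : ℤ)) σ *
      E.topWeight D.n (pottsWeight 0) σ = 2 := E.sum_topWeight_sq
  have h3 : ∑ σ : ZMod D.n → Fin 2, D.topWeight D.n (pottsWeight (0 : ℤ)) σ *
      E.topWeight D.n (pottsWeight 0) σ = 2 := by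
    have := D.chromaticValue_graph
    rw [h, partitionFunction] at this
    simp only [hb] at this
    exact this.symm
  -- The squared distance of the two indicator vectors is `2 + 2 - 2 * 2 = 0`.
  have h4 : ∑ σ : ZMod D.n → Fin 2, (D.topWeight D.n (pottsWeight (0 : ℤ)) σ -
      E.topWeight D.n (pottsWeight 0) σ) ^ 2 = 0 := by
    have : ∀ a b : ℤ, (a - b) ^ 2 = a * a + b * b - 2 * (a * b) := fun a b => by ring
    simp only [this, Finset.sum_sub_distrib, Finset.sum_add_distrib, ← Finset.mul_sum, h1, h2, h3]
    norm_num
  rw [Finset.sum_eq_zero_iff_of_nonneg fun _ _ => sq_nonneg _] at h4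
  rw [hb]
  exact sub_eq_zero.1 (pow_eq_zero_iff two_ne_zero |>.1 (h4 σ (Finset.mem_univ σ)))

/-- Both top half-graphs have the proper 2-colourings of the common bottom tree, so the sum for the
quotient is a sum of squares as in `sum_topWeight_sq`. -/
theorem chromaticValue_quotient (hD : chromaticValue D.graph 2 = 2)
    (hD' : chromaticValue D'.graph 2 = 2) (h : D.bottom = D'.bottom) :
    chromaticValue (D.quotient D' h).graph 2 = 2 := by
  have h1 : (chromaticValue (D.quotient D' h).graph 2 : ℤ) = 2 := by
    rw [chromaticValue_graph, partitionFunction_quotient _ _ h D'.n rfl, ← D'.sum_topWeight_sq]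
    refine Finset.sum_congr rfl fun σ _ => ?_
    congr 1
    rw [topWeight_eq_weight_bottom hD']
    obtain ⟨S, T, hn, c, hc⟩ := D
    obtain rfl : T = D'.bottom := h
    exact topWeight_eq_weight_bottom hD σ
  exact_mod_cast h1

end TreeDiagram

/-! ### The oriented subgroup and positivity of the Jones function -/

open TreeDiagram

/-- Diagrams with a common bottom tree for finitely many elements. -/
theorem exists_common_diagrams {ι : Type*} [Fintype ι] (g : ι → thompsonT)
    (h : ∀ i, ∃ D : TreeDiagram, D.Represents (g i)) :
    ∃ (u : BinTree) (D : ι → TreeDiagram), ∀ i, (D i).Represents (g i) ∧ (D i).bottom = u := by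
  choose D hD using h
  obtain ⟨u, hu⟩ := BinTree.exists_common_refinement_family fun i => (D i).bottom
  choose E hE hEu using fun i => exists_expands (D i) (hu i)
  exact ⟨u, E, fun i => ⟨(hE i).represents (hD i), hEu i⟩⟩

theorem IsOrientedElement.chromaticValue_eq {g : thompsonT} (hg : IsOrientedElement g)
    {D : TreeDiagram} (hD : D.Represents g) : chromaticValue D.graph 2 = 2 := by
  obtain ⟨D', hD', h⟩ := hg
  rw [hD.chromaticValue_eq hD', h]

theorem isOrientedElement_one : IsOrientedElement 1 :=
  ⟨trivialDiagram, represents_trivialDiagram, chromaticValue_trivialDiagram⟩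

theorem IsOrientedElement.mul_inv {g h : thompsonT} (hg : IsOrientedElement g)
    (hh : IsOrientedElement h) : IsOrientedElement (g * h⁻¹) := by
  obtain ⟨u, D, hD⟩ := exists_common_diagrams ![g, h] fun i => by
    fin_cases i
    exacts [hg.imp fun _ => And.left, hh.imp fun _ => And.left]
  have h0 : (D 0).Represents g := (hD 0).1
  have h1 : (D 1).Represents h := (hD 1).1
  have hb : (D 0).bottom = (D 1).bottom := (hD 0).2.trans (hD 1).2.symm
  exact ⟨_, h0.quotient h1 hb,
    chromaticValue_quotient (hg.chromaticValue_eq h0) (hh.chromaticValue_eq h1) hb⟩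

/-- The oriented subgroup of Thompson's group `T`. -/
def orientedSubgroup : Subgroup thompsonT where
  carrier := {g | IsOrientedElement g}
  one_mem' := isOrientedElement_one
  inv_mem' {g} hg := by
    have := isOrientedElement_one.mul_inv (h := g) hg
    rwa [one_mul] at this
  mul_mem' {g h} hg hh := by
    have h1 := isOrientedElement_one.mul_inv (h := h) hh
    have h2 := IsOrientedElement.mul_inv (g := g) hg h1
    rwa [one_mul, inv_inv] at h2

/-- Upper and lower weights are inverse to each other, so each of the `q` colours contributes 1. -/
theorem sum_pottsWeight_mul {q : ℕ} {t : ℂ} (ht : t ≠ 0) (a : Fin q) :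
    ∑ c : Fin q, pottsWeight (-t) a c * pottsWeight (-t⁻¹) a c = q := by
  have h : ∀ c : Fin q, pottsWeight (-t) a c * pottsWeight (-t⁻¹) a c = 1 := fun c => by
    rw [pottsWeight, pottsWeight]
    split_ifs
    · rw [neg_mul_neg, mul_inv_cancel₀ ht]
    · rw [one_mul]
  simp [h]

/-- The Jones function is of positive type wherever `t + 2 + t⁻¹` is a positive integer and `t` has
absolute value `1`. -/
theorem exists_jonesFunction {t : ℂ} {q : ℕ} (hq : q ≠ 0) (ht : star t = t⁻¹) (ht0 : t ≠ 0)
    (hqt : (q : ℂ) = t + 2 + t⁻¹) :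
    ∃ V : orientedSubgroup → ℂ, IsJonesFunction t V ∧ IsPositiveType V := by
  have hq0 : (q : ℂ) ≠ 0 := Nat.cast_ne_zero.2 hq
  have hex : ∀ g : orientedSubgroup, ∃ D : TreeDiagram, D.Represents g :=
    fun g => g.2.imp fun _ => And.left
  choose D hD using hex
  let Z : TreeDiagram → ℂ := fun E => ((q : ℂ) ^ E.n)⁻¹ *
    E.partitionFunction (pottsWeight (C := Fin q) (-t)) (pottsWeight (-t⁻¹))
  have hZ : ∀ (g : orientedSubgroup) (E : TreeDiagram), E.Represents g → Z (D g) = Z E := by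
    intro g E hE
    have := (hD g).partitionFunction_eq (sum_pottsWeight_mul (q := q) ht0) hq0 hE
    simp only [Z]
    rw [inv_mul_eq_div, inv_mul_eq_div, div_eq_div_iff (pow_ne_zero _ hq0) (pow_ne_zero _ hq0),
      mul_comm, this, mul_comm]
  refine ⟨fun g => Z (D g), ?_, ?_⟩
  · intro g E hE σ _ A hA
    rw [jonesValue_eq hq ht0 hqt hA σ]
    exact hZ g E hE
  · intro r g
    obtain ⟨u, E, hE⟩ := exists_common_diagrams (fun i => (g i : thompsonT)) fun i => ⟨_, hD (g i)⟩
    have : NeZero u.numLeaves := ⟨u.numLeaves_pos.ne'⟩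
    let B : Matrix (Fin r) (ZMod u.numLeaves → Fin q) ℂ :=
      Matrix.of fun i σ => (E i).topWeight u.numLeaves (pottsWeight (-t)) σ
    -- For `|t| = 1` the weights of the lower half-graph are conjugates of upper weights, so the
    -- matrix is a Gram matrix whose rows are indexed by the elements and columns by colourings of
    -- the common bottom tree.
    have hM : (Matrix.of fun i j => Z (D (g i * (g j)⁻¹))) =
        ((q : ℂ) ^ u.numLeaves)⁻¹ • (B * B.conjTranspose) := by
      ext i j
      have hb : (E i).bottom = (E j).bottom := (hE i).2.trans (hE j).2.symm
      have hn : (E j).n = u.numLeaves := congrArg BinTree.numLeaves (hE j).2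
      have hnq : ((E i).quotient (E j) hb).n = u.numLeaves := (E j).numLeaves_eq.trans hn
      rw [Matrix.of_apply, hZ _ _ ((hE i).1.quotient (hE j).1 hb), Matrix.smul_apply,
        Matrix.mul_apply, smul_eq_mul]
      simp only [Z]
      rw [hnq, partitionFunction_quotient _ _ hb _ hn]
      simp only [B, Matrix.conjTranspose_apply, Matrix.of_apply, topWeight_conj, star_neg, ht]
    rw [hM]
    refine (Matrix.posSemidef_self_mul_conjTranspose B).smul ?_
    rw [← Nat.cast_pow, ← Complex.ofReal_natCast, ← Complex.ofReal_inv, Complex.zero_le_real]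
    positivity

theorem theorem7p4 :
    ∃ vecT : Subgroup thompsonT,
      (∀ g : thompsonT, g ∈ vecT ↔ IsOrientedElement g) ∧
      (∀ g ∈ vecT, ∀ D : TreeDiagram, D.Represents g → chromaticValue D.graph 2 = 2) ∧
      ∀ t ∈ ({1, Complex.I, Complex.exp (Complex.I * Real.pi / 3),
          Complex.exp (-(Complex.I * Real.pi / 3))} : Set ℂ),
        ∃ V : vecT → ℂ, IsJonesFunction t V ∧ IsPositiveType V := by
  refine ⟨orientedSubgroup, fun g => Iff.rfl, fun g hg D hD => hg.chromaticValue_eq hD, ?_⟩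
  have hexp : Complex.exp (Complex.I * Real.pi / 3) + Complex.exp (-(Complex.I * Real.pi / 3)) =
      1 := by
    have h1 : Complex.I * Real.pi / 3 = ((Real.pi / 3 : ℝ) : ℂ) * Complex.I := by
      push_cast
      ring
    rw [h1, ← neg_mul, ← Complex.two_cos, ← Complex.ofReal_cos, Real.cos_pi_div_three]
    norm_num
  have hstar : star (Complex.I * Real.pi / 3) = -(Complex.I * Real.pi / 3) := by
    simp [neg_div]
  have hexp_star : ∀ z : ℂ, star (Complex.exp z) = Complex.exp (star z) :=
    fun z => (Complex.exp_conj z).symm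
  rintro t (rfl | rfl | rfl | rfl)
  -- On the unit circle `q` is 2 plus twice the real part of `t`: 4 at `1`, 2 at `i`, and 3 at the
  -- two sixth roots of unity.
  · exact exists_jonesFunction (q := 4) (by norm_num) (by simp) one_ne_zero (by norm_num)
  · exact exists_jonesFunction (q := 2) (by norm_num) (by simp) Complex.I_ne_zero (by simp)
  · refine exists_jonesFunction (q := 3) (by norm_num) ?_ (Complex.exp_ne_zero _) ?_
    · rw [hexp_star, hstar, Complex.exp_neg]
    · rw [← Complex.exp_neg, add_right_comm, hexp]
      norm_num
  · refine exists_jonesFunction (q := 3) (by norm_num) ?_ (Complex.exp_ne_zero _) ?_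
    · rw [hexp_star, star_neg, hstar, ← Complex.exp_neg]
    · rw [← Complex.exp_neg, neg_neg, add_right_comm, add_comm (Complex.exp _), hexp]
      norm_num
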